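/- Setting. Fix a probability space, a number $N$ of nodes and a parameter dimension $n$, and a deterministic true parameter $x_0\in\mathbb R^n$. For $k\ge 0$ let $\mathcal A(k)=[w_{ij}(k)]$ be a random $N\times N$ weighted adjacency matrix with zero diagonal, with neighbourhoods $\mathcal N_i(k)=\{j: w_{ij}(k)\neq 0\}$; let $\mathcal L(k)=\mathrm{diag}\big(\sum_j w_{1j}(k),\dots,\sum_j w_{Nj}(k)\big)-\mathcal A(k)$ be its Laplacian and $\widehat{\mathcal L}(k)=\frac12(\mathcal L(k)+\mathcal L(k)^T)$. Let $H_i(k)\in\mathbb R^{n_i\times n}$ be random regression matrices, $v_i(k)\in\mathbb R^{n_i}$ and $\xi_{ji}(k)\in\mathbb R^n$ ($1\le i,j\le N$) random noises, $f_{ji}:\mathbb R^n\to\mathbb R$ measurable functions, and $a(k),b(k),\lambda(k)$ deterministic real gains. Put $y_i(k)=H_i(k)x_0+v_i(k)$ and, from deterministic initial values $x_i(0)$, define $$x_i(k+1)=x_i(k)+a(k)H_i(k)^T\big(y_i(k)-H_i(k)x_i(k)\big)+b(k)\sum_{j\in\mathcal N_i(k)}w_{ij}(k)\big(x_j(k)+f_{ji}(x_j(k)-x_i(k))\,\xi_{ji}(k)-x_i(k)\big)-\lambda(k)x_i(k).$$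 Let $\mathcal H(k)=\mathrm{diag}(H_1(k),\dots,H_N(k))$ (block diagonal), let $v(k)$ and $\xi(k)$ be the stacked vectors of all $v_i(k)$ and all $\xi_{ji}(k)$, let $\mathcal F(k)=\sigma(\mathcal A(s),H_i(s),v_i(s),\xi_{ji}(s): 1\le i,j\le N,\ 0\le s\le k)$ with $\mathcal F(-1)$ trivial, let $\delta(k)=(x_i(k)-x_0)_{1\le i\le N}\in\mathbb R^{Nn}$ and $V(k)=\|\delta(k)\|^2$. With $\|\cdot\|$ the Euclidean/spectral norm and $\lambda_{\min}$ the minimum eigenvalue of a real symmetric matrix, put, for a positive integer $h$, $$\Lambda_k^h=\lambda_{\min}\Big[\sum_{i=kh}^{(k+1)h-1}\Big(b(i)\,\mathbb E[\widehat{\mathcal L}(i)\mid\mathcal F(kh-1)]\otimes I_n+a(i)\,\mathbb E[\mathcal H(i)^T\mathcal H(i)\mid\mathcal F(kh-1)]\Big)\Big].$$ Assumptions. (A1) There are constants $\sigma,c$ with $|f_{ji}(z)|\le\sigma\|z\|+c$ for all $i,j$ and all $z\in\mathbb R^n$. (A2) $\{v(k),\mathcal F(k)\}$ and $\{\xi(k),\mathcal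 F(k)\}$ are martingale difference sequences, the family of noises $\{v(k),\xi(k):k\ge0\}$ is independent of $\{\mathcal H(k),\mathcal A(k):k\ge 0\}$, and there is a constant $\beta_v$ with $\sup_{k\ge0}\mathbb E[\|v(k)\|^2+\|\xi(k)\|^2\mid\mathcal F(k-1)]\le\beta_v$ a.s. Lemma. Suppose (A1) and (A2) hold, each of $a(k),b(k),\lambda(k)$ decreases monotonically (is nonincreasing) to zero, and there are a positive integer $h$ and a constant $\rho_0>0$ such that $$\sup_{k\ge 0}\Big(\|\mathcal L(k)\|+\big(\mathbb E[\|\mathcal H(k)^T\mathcal H(k)\|^{p}\mid\mathcal F(k-1)]\big)^{1/p}\Big)\le\rho_0\ \text{ a.s.},\qquad p=2^{\max\{h,2\}}.$$ Then every $V(k)$ is integrable, and there exist nonnegative deterministic real sequences $\{\Omega(k)\}$ and $\{\Gamma(k)\}$ with $\Omega(k)+\Gamma(k)=\mathcal O\big(a^2(kh)+b^2(kh)+\lambda(kh)\big)$ as $k\to\infty$, and a positive integer $k_0$, such that for all $k\ge k_0$, almost surely, $$\mathbb E[V((k+1)h)\mid\mathcal F(kh-1)]\le(1+\Omega(k))V(kh)-2\Big(\Lambda_k^h+\sum_{i=kh}^{(k+1)h-1}\lambda(i)\Big)V(kh)+\Gamma(k).$$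 -/

import Mathlib

open MeasureTheory ProbabilityTheory Filter Topology Asymptotics
open scoped Kronecker

/-- Spectral norm (operator norm for the Euclidean norms) of a real matrix. -/
noncomputable def specNorm {m n : Type*} [Fintype m] [Fintype n] [DecidableEq n]
    (A : Matrix m n ℝ) : ℝ :=
  ‖(Matrix.toEuclideanLin A).toContinuousLinearMap‖

/-- Minimum eigenvalue of a real symmetric matrix. -/
noncomputable def lambdaMin {m : Type*} [Fintype m] [DecidableEq m] (A : Matrix m m ℝ) : ℝ :=
  sInf (spectrum ℝ A)

/-- Entrywise conditional expectation of a random matrix. -/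
noncomputable def condMat {Ω : Type*} {mΩ : MeasurableSpace Ω} {m n : Type*}
    (P : Measure Ω) (F : MeasurableSpace Ω) (X : Ω → Matrix m n ℝ) (ω : Ω) : Matrix m n ℝ :=
  Matrix.of fun r c => (P[fun ω' => X ω' r c | F]) ω

/-- Data of the decentralized online regularized linear regression problem with `N` nodes and
parameter dimension `n` on a sample space `Ω`: random digraphs (through their weighted adjacency
matrices), random regression matrices, measurement and communication noises, noise intensity
functions, the true parameter, deterministic initial estimates, and deterministic gains. -/
structure RegressionNetwork (Ω : Type*) [MeasurableSpace Ω] (N n : ℕ) where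
  /-- `dim i` is the dimension of the observations of node `i`. -/
  dim : Fin N → ℕ
  /-- `A k ω i j` is the weight `w_ij(k)` of the edge from `j` to `i`. -/
  A : ℕ → Ω → Matrix (Fin N) (Fin N) ℝ
  /-- regression matrix of node `i` at time `k` -/
  H : (i : Fin N) → ℕ → Ω → Matrix (Fin (dim i)) (Fin n) ℝ
  /-- measurement noise of node `i` at time `k` -/
  v : (i : Fin N) → ℕ → Ω → EuclideanSpace ℝ (Fin (dim i))
  /-- `ξ j i k` is the noise on the communication from `j` to `i` at time `k`. -/
  ξ : Fin N → Fin N → ℕ → Ω → EuclideanSpace ℝ (Fin n)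
  /-- noise intensity function `f_ji` -/
  f : Fin N → Fin N → EuclideanSpace ℝ (Fin n) → ℝ
  /-- true parameter -/
  x₀ : EuclideanSpace ℝ (Fin n)
  /-- initial estimates -/
  xInit : Fin N → EuclideanSpace ℝ (Fin n)
  /-- innovation gain -/
  a : ℕ → ℝ
  /-- consensus gain -/
  b : ℕ → ℝ
  /-- regularization gain -/
  lam : ℕ → ℝ
  A_diag : ∀ k ω i, A k ω i i = 0
  measurable_A : ∀ k i j, Measurable fun ω => A k ω i j
  measurable_H : ∀ i k r c, Measurable fun ω => H i k ω r c
  measurable_v : ∀ i k, Measurable (v i k)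
  measurable_ξ : ∀ j i k, Measurable (ξ j i k)
  measurable_f : ∀ j i, Measurable (f j i)

namespace RegressionNetwork

variable {Ω : Type*} [MeasurableSpace Ω] {N n : ℕ} (S : RegressionNetwork Ω N n)

/-- Observation `y_i(k) = H_i(k) x₀ + v_i(k)`. -/
noncomputable def y (i : Fin N) (k : ℕ) (ω : Ω) : EuclideanSpace ℝ (Fin (S.dim i)) :=
  Matrix.toEuclideanLin (S.H i k ω) S.x₀ + S.v i k ω

open Classical in
/-- Neighbours of `i`: the `j` with an edge from `j` to `i`. -/
noncomputable def nbr (k : ℕ) (ω : Ω) (i : Fin N) : Finset (Fin N) :=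
  Finset.univ.filter fun j => S.A k ω i j ≠ 0

/-- The algorithm: `S.x k ω i` is the estimate `x_i(k)` of node `i` at time `k`. What `i` receives
from its neighbour `j` is `x_j(k) + f_ji(x_j(k) - x_i(k)) ξ_ji(k)`. -/
noncomputable def x : ℕ → Ω → Fin N → EuclideanSpace ℝ (Fin n)
  | 0, _, i => S.xInit i
  | k + 1, ω, i =>
      x k ω i
      + S.a k • Matrix.toEuclideanLin (S.H i k ω).transpose
          (S.y i k ω - Matrix.toEuclideanLin (S.H i k ω) (x k ω i))
      + S.b k • ∑ j ∈ S.nbr k ω i, S.A k ω i j •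
          (x k ω j + S.f j i (x k ω j - x k ω i) • S.ξ j i k ω - x k ω i)
      - S.lam k • x k ω i

/-- Global estimation error `δ(k) = x(k) - 1_N ⊗ x₀`. -/
noncomputable def δ (k : ℕ) (ω : Ω) : EuclideanSpace ℝ (Fin N × Fin n) :=
  WithLp.toLp 2 fun p => S.x k ω p.1 p.2 - S.x₀ p.2

/-- `V(k) = ‖δ(k)‖²`. -/
noncomputable def V (k : ℕ) (ω : Ω) : ℝ := ‖S.δ k ω‖ ^ 2

/-- Stacked measurement noise `v(k)`. -/
noncomputable def vStack (k : ℕ) (ω : Ω) : EuclideanSpace ℝ (Σ i, Fin (S.dim i)) :=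
  WithLp.toLp 2 fun p => S.v p.1 k ω p.2

/-- Stacked communication noise `ξ(k)`. -/
noncomputable def ξStack (k : ℕ) (ω : Ω) : EuclideanSpace ℝ (Fin N × Fin N × Fin n) :=
  WithLp.toLp 2 fun p => S.ξ p.2.1 p.1 k ω p.2.2

/-- The block diagonal matrix `diag(H_1(k), …, H_N(k))`. -/
def HBlock (k : ℕ) (ω : Ω) : Matrix (Σ i, Fin (S.dim i)) (Fin N × Fin n) ℝ :=
  Matrix.of fun r c => if r.1 = c.1 then S.H r.1 k ω r.2 c.2 else 0

/-- `diag(H_1(k), …, H_N(k))ᵀ diag(H_1(k), …, H_N(k))`. -/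
def gram (k : ℕ) (ω : Ω) : Matrix (Fin N × Fin n) (Fin N × Fin n) ℝ :=
  (S.HBlock k ω).transpose * S.HBlock k ω

/-- Laplacian matrix: diagonal matrix of in-degrees minus the adjacency matrix. -/
def lap (k : ℕ) (ω : Ω) : Matrix (Fin N) (Fin N) ℝ :=
  Matrix.diagonal (fun i => ∑ j, S.A k ω i j) - S.A k ω

/-- Symmetrized Laplacian. -/
noncomputable def lapSym (k : ℕ) (ω : Ω) : Matrix (Fin N) (Fin N) ℝ :=
  (1 / 2 : ℝ) • (S.lap k ω + (S.lap k ω).transpose)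

/-- σ-algebra generated by the graph and the regression matrices at time `s`. -/
@[reducible] def sigmaGH (s : ℕ) : MeasurableSpace Ω :=
  (⨆ i, ⨆ j, MeasurableSpace.comap (fun ω => S.A s ω i j) (borel ℝ)) ⊔
  (⨆ i, ⨆ r, ⨆ c, MeasurableSpace.comap (fun ω => S.H i s ω r c) (borel ℝ))

/-- σ-algebra generated by all the noises at time `s`. -/
@[reducible] noncomputable def sigmaNoise (s : ℕ) : MeasurableSpace Ω :=
  MeasurableSpace.comap (S.vStack s) (borel _) ⊔ MeasurableSpace.comap (S.ξStack s) (borel _)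

/-- `S.past k` is `𝓕(k - 1)`, where `𝓕(k)` is generated by the graphs, regression matrices and
noises at the times `0, …, k`, and `𝓕(-1)` is trivial. -/
@[reducible] noncomputable def past (k : ℕ) : MeasurableSpace Ω := ⨆ s, ⨆ _ : s < k, S.sigmaGH s ⊔ S.sigmaNoise s

/-- `Λ_k^h`. -/
noncomputable def Lam (P : Measure Ω) (h k : ℕ) (ω : Ω) : ℝ :=
  lambdaMin (∑ i ∈ Finset.Ico (k * h) ((k + 1) * h),
    (S.b i • (condMat P (S.past (k * h)) (S.lapSym i) ω ⊗ₖ (1 : Matrix (Fin n) (Fin n) ℝ))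
      + S.a i • condMat P (S.past (k * h)) (S.gram i) ω))

/-- Assumption (A1): linear growth of the noise intensity functions. -/
def A1 : Prop := ∃ σ c : ℝ, ∀ j i z, |S.f j i z| ≤ σ * ‖z‖ + c

/-- Assumption (A2): the noises are martingale differences with respect to `𝓕` (adaptedness holds
by construction of `𝓕`), the noises are independent of the graphs and regression matrices, and
their conditional second moments are uniformly bounded. -/
structure A2 (P : Measure Ω) : Prop where
  integrable_v : ∀ k, Integrable (S.vStack k) P
  integrable_ξ : ∀ k, Integrable (S.ξStack k) P
  condExp_v : ∀ k, P[S.vStack k | S.past k] =ᵐ[P] 0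
  condExp_ξ : ∀ k, P[S.ξStack k | S.past k] =ᵐ[P] 0
  indep : Indep (⨆ k, S.sigmaNoise k) (⨆ k, S.sigmaGH k) P
  integrable_sq : ∀ k, Integrable (fun ω => ‖S.vStack k ω‖ ^ 2 + ‖S.ξStack k ω‖ ^ 2) P
  bound : ∃ β : ℝ, ∀ᵐ ω ∂P, ∀ k,
    (P[fun ω' => ‖S.vStack k ω'‖ ^ 2 + ‖S.ξStack k ω'‖ ^ 2 | S.past k]) ω ≤ β

/-- Uniform bound `ρ₀` on the Laplacians and on the conditional `L^p` norms, `p = 2^max(h,2)`, of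
the Gram matrices of the regressors. -/
structure UniformBound (P : Measure Ω) (h : ℕ) (ρ₀ : ℝ) : Prop where
  integrable_gram : ∀ k, Integrable (fun ω => specNorm (S.gram k ω) ^ (2 ^ max h 2)) P
  bound : ∀ᵐ ω ∂P, ∀ k, specNorm (S.lap k ω)
    + ((P[fun ω' => specNorm (S.gram k ω') ^ (2 ^ max h 2) | S.past k]) ω)
        ^ (1 / (2 ^ max h 2 : ℝ)) ≤ ρ₀

end RegressionNetwork

/-! ### Conditional expectations: pulling out factors, towers, independence. -/

section CondExp

variable {Ω : Type*} {mΩ : MeasurableSpace Ω} {P : Measure Ω}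

/-! The error obeys δ(k+1) − δ(k) = −B(k)δ(k) − λ(k)(δ(k) + 1⊗x₀) + noise, with B(k) = b(k)L(k)⊗I +
a(k)H(k)ᵀH(k). Put e = a + b + λ. One step has squared length at most e(k)²R(k)(1 + V(k)), where
R(k) is random with conditional mean bounded uniformly in k (`exists_step_bounds`,
`A2.condLE_stepFactor`). Expanding the square gives V(k+1) ≤ V(k) − 2⟨δ(k), B(k)δ(k)⟩ + 2(noise term
of zero conditional mean) + (e(k)² + λ(k))R(k)(1 + V(k)).

Over h steps from time m the h-fold product of transition matrices is never expanded. The one-step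
bound is iterated with the tower property: E[V(m+j) | F(m−1)] is O(1 + V(m)) and E[‖δ(m+j) − δ(m)‖²
| F(m−1)] is O(e(m)²(1 + V(m))). Hence the form ⟨δ, B(i)δ⟩ at δ(i) may be replaced by its value at
δ(m) at a cost of second order (`GainBoundedProcess.condLE_drift`). With the vector frozen,
conditioning acts on the matrices alone, the h forms add up, and the minimum eigenvalue of the
summed conditional means bounds them below (`Lam_mul_V_le`).

R(k) multiplies moments of the regressors and of the noises at the same time k. These factor given
the past because the two families are independent (`condExp_mul_of_indep`). The regularization
counts as an error of order λ throughout; the term −2Σλ(i)V of the conclusion is of that order and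
is balanced by the choice of Ω. -/

theorem integrable_of_ae_tendsto_of_integral_le {f : ℕ → Ω → ℝ} {g : Ω → ℝ} {c : ℝ}
    (hi : ∀ N, Integrable (f N) P) (h0 : ∀ N ω, 0 ≤ f N ω) (hc : ∀ N, ∫ ω, f N ω ∂P ≤ c)
    (ht : ∀ᵐ ω ∂P, Tendsto (fun N => f N ω) atTop (𝓝 (g ω))) : Integrable g P := by
  refine ⟨aestronglyMeasurable_of_tendsto_ae _ (fun N => (hi N).1) ht, ?_⟩
  have hfatou : ∫⁻ ω, ‖g ω‖ₑ ∂P ≤ liminf (fun N => ∫⁻ ω, ‖f N ω‖ₑ ∂P) atTop := by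
    refine le_trans (lintegral_mono_ae ?_)
      (lintegral_liminf_le' fun N => (hi N).1.aemeasurable.enorm)
    filter_upwards [ht] with ω hω
    exact hω.enorm.liminf_eq.ge
  refine lt_of_le_of_lt hfatou
    (lt_of_le_of_lt (b := ENNReal.ofReal c) ?_ ENNReal.ofReal_lt_top)
  refine liminf_le_of_frequently_le' (Frequently.of_forall fun N => ?_)
  refine le_trans ?_ (ENNReal.ofReal_le_ofReal (hc N))
  rw [ofReal_integral_eq_lintegral_ofReal (hi N) (ae_of_all _ fun ω => h0 N ω)]
  refine lintegral_mono fun ω => ?_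
  rw [← ofReal_norm, Real.norm_of_nonneg (h0 N ω)]

variable [IsProbabilityMeasure P]

/-- A nonnegative factor known at `F` can be pulled out of a conditional bound; integrability of
the product is part of the conclusion. -/
theorem condExp_mul_le_of_condExp_le {F : MeasurableSpace Ω} (hF : F ≤ mΩ) {Z Y : Ω → ℝ} {c : ℝ}
    (hZ : StronglyMeasurable[F] Z) (hZ0 : ∀ ω, 0 ≤ Z ω) (hZi : Integrable Z P)
    (hY0 : ∀ ω, 0 ≤ Y ω) (hYi : Integrable Y P) (hc : ∀ᵐ ω ∂P, (P[Y | F]) ω ≤ c) :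
    Integrable (fun ω => Z ω * Y ω) P ∧
      ∀ᵐ ω ∂P, (P[fun ω => Z ω * Y ω | F]) ω ≤ c * Z ω := by
  have hint : Integrable (fun ω => Z ω * Y ω) P := by
    -- The pull-out rule needs an integrable product, so it is applied to bounded truncations of
    -- `Z`; their integrals are uniformly bounded and Fatou's lemma gives integrability of the
    -- limit.
    set Zn : ℕ → Ω → ℝ := fun N ω => min (Z ω) N with hZn
    have hZnm : ∀ N, StronglyMeasurable[F] (Zn N) := fun N =>
      hZ.inf stronglyMeasurable_const
    have hZn0 : ∀ N ω, 0 ≤ Zn N ω := fun N ω => le_min (hZ0 ω) N.cast_nonneg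
    have hi : ∀ N, Integrable (fun ω => Zn N ω * Y ω) P := fun N => by
      refine hYi.bdd_mul (c := N) ((hZnm N).mono hF).aestronglyMeasurable ?_
      filter_upwards with ω
      rw [Real.norm_of_nonneg (hZn0 N ω)]
      exact min_le_right _ _
    have hb : ∀ N, ∫ ω, Zn N ω * Y ω ∂P ≤ |c| * ∫ ω, Z ω ∂P := fun N => by
      rw [← integral_condExp hF, ← integral_const_mul]
      refine integral_mono_ae integrable_condExp (hZi.const_mul _) ?_
      have h1 := condExp_mul_of_stronglyMeasurable_left (m := F) (μ := P) (hZnm N) (hi N) hYi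
      filter_upwards [h1, hc] with ω h1 hc
      refine h1.le.trans ?_
      have hzz : Zn N ω ≤ Z ω := min_le_left _ _
      calc Zn N ω * (P[Y | F]) ω ≤ Zn N ω * |c| :=
            mul_le_mul_of_nonneg_left (hc.trans (le_abs_self c)) (hZn0 N ω)
        _ ≤ |c| * Z ω := by rw [mul_comm]; exact mul_le_mul_of_nonneg_left hzz (abs_nonneg c)
    refine integrable_of_ae_tendsto_of_integral_le hi
      (fun N ω => mul_nonneg (hZn0 N ω) (hY0 ω)) hb (ae_of_all _ fun ω => ?_)
    refine tendsto_const_nhds.congr' ?_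
    filter_upwards [eventually_ge_atTop ⌈Z ω⌉₊] with N hN
    rw [hZn]
    simp only
    rw [min_eq_left ((Nat.le_ceil _).trans (by exact_mod_cast hN))]
  refine ⟨hint, ?_⟩
  have h1 := condExp_mul_of_stronglyMeasurable_left (m := F) (μ := P) hZ hint hYi
  filter_upwards [h1, hc] with ω h1 hc
  refine h1.le.trans ?_
  rw [mul_comm c]
  exact mul_le_mul_of_nonneg_left hc (hZ0 ω)

theorem condExp_le_of_condExp_le {F₁ F₂ : MeasurableSpace Ω} (h12 : F₁ ≤ F₂) (h2 : F₂ ≤ mΩ)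
    {Y Z : Ω → ℝ} (hZi : Integrable Z P) (hYZ : ∀ᵐ ω ∂P, (P[Y | F₂]) ω ≤ Z ω) :
    ∀ᵐ ω ∂P, (P[Y | F₁]) ω ≤ (P[Z | F₁]) ω := by
  have h1 := condExp_condExp_of_le (μ := P) (f := Y) h12 h2
  have h3 := condExp_mono (m := F₁) (μ := P) integrable_condExp hZi hYZ
  filter_upwards [h1, h3] with ω h1 h3
  rw [← h1]; exact h3

/-- Factorization of a conditional expectation given a join of sub-σ-algebras of two independent
σ-algebras. -/
theorem condExp_mul_of_indep {G N G' N' : MeasurableSpace Ω} (hG : G ≤ mΩ) (hN : N ≤ mΩ)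
    (hG' : G' ≤ G) (hN' : N' ≤ N) (hind : Indep G N P) {g η : Ω → ℝ}
    (hg : StronglyMeasurable[G] g) (hη : StronglyMeasurable[N] η)
    (hgi : Integrable g P) (hηi : Integrable η P) :
    Integrable (fun ω => g ω * η ω) P ∧
      P[fun ω => g ω * η ω | G' ⊔ N'] =ᵐ[P] fun ω => (P[g | G']) ω * (P[η | N']) ω := by
  have key : ∀ u w : Ω → ℝ, StronglyMeasurable[G] u → StronglyMeasurable[N] w →
      Integrable u P → Integrable w P → Integrable (fun ω => u ω * w ω) P ∧
        ∫ ω, u ω * w ω ∂P = (∫ ω, u ω ∂P) * ∫ ω, w ω ∂P := by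
    intro u w hu hw hui hwi
    have hi : IndepFun u w P := by
      rw [IndepFun_iff_Indep]
      exact indep_of_indep_of_le_left (indep_of_indep_of_le_right hind hw.measurable.comap_le)
        hu.measurable.comap_le
    exact ⟨hi.integrable_mul hui hwi, hi.integral_fun_mul_eq_mul_integral
      hui.aestronglyMeasurable hwi.aestronglyMeasurable⟩
  have hFm : G' ⊔ N' ≤ mΩ := sup_le (hG'.trans hG) (hN'.trans hN)
  have hi1 := (key g η hg hη hgi hηi).1
  have hi2 := (key _ _ (stronglyMeasurable_condExp.mono hG' : StronglyMeasurable[G] (P[g | G']))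
    (stronglyMeasurable_condExp.mono hN' : StronglyMeasurable[N] (P[η | N']))
    integrable_condExp integrable_condExp).1
  refine ⟨hi1, ?_⟩
  symm
  refine ae_eq_condExp_of_forall_setIntegral_eq hFm hi1 (fun s _ _ => hi2.integrableOn) ?_ ?_
  swap
  · exact ((stronglyMeasurable_condExp.mono le_sup_left).mul
      (stronglyMeasurable_condExp.mono le_sup_right)).aestronglyMeasurable
  intro s hs _
  -- Rectangles `A ∩ B` form a π-system generating the join. On them independence splits both
  -- integrals into the same product.
  have hgen : G' ⊔ N' = MeasurableSpace.generateFrom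
      {t | ∃ A B, MeasurableSet[G'] A ∧ MeasurableSet[N'] B ∧ t = A ∩ B} := by
    apply le_antisymm
    · refine sup_le (fun A hA => ?_) (fun B hB => ?_)
      · exact MeasurableSpace.measurableSet_generateFrom
          ⟨A, Set.univ, hA, @MeasurableSet.univ _ N', by simp⟩
      · exact MeasurableSpace.measurableSet_generateFrom
          ⟨Set.univ, B, @MeasurableSet.univ _ G', hB, by simp⟩
    · refine MeasurableSpace.generateFrom_le ?_
      rintro t ⟨A, B, hA, hB, rfl⟩
      exact @MeasurableSet.inter _ (G' ⊔ N') _ _ ((le_sup_left : G' ≤ G' ⊔ N') _ hA)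
        ((le_sup_right : N' ≤ G' ⊔ N') _ hB)
  have hpi : IsPiSystem {t | ∃ A B, MeasurableSet[G'] A ∧ MeasurableSet[N'] B ∧ t = A ∩ B} := by
    rintro _ ⟨A, B, hA, hB, rfl⟩ _ ⟨A', B', hA', hB', rfl⟩ _
    exact ⟨A ∩ A', B ∩ B', @MeasurableSet.inter _ G' _ _ hA hA',
      @MeasurableSet.inter _ N' _ _ hB hB', Set.inter_inter_inter_comm _ _ _ _⟩
  have rect : ∀ (u w : Ω → ℝ), StronglyMeasurable[G] u → StronglyMeasurable[N] w →
      Integrable u P → Integrable w P → ∀ A B, MeasurableSet[G'] A → MeasurableSet[N'] B →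
      ∫ ω in A ∩ B, u ω * w ω ∂P = (∫ ω in A, u ω ∂P) * ∫ ω in B, w ω ∂P := by
    intro u w hu hw hui hwi A B hA hB
    have hAm := hG _ (hG' _ hA)
    have hBm := hN _ (hN' _ hB)
    have := (key (A.indicator u) (B.indicator w) (hu.indicator (hG' _ hA))
      (hw.indicator (hN' _ hB)) (hui.indicator hAm) (hwi.indicator hBm)).2
    rw [integral_indicator hAm, integral_indicator hBm] at this
    rw [← this, ← integral_indicator (hAm.inter hBm)]
    congr 1 with ω
    by_cases h1 : ω ∈ A <;> by_cases h2 : ω ∈ B <;> simp [h1, h2]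
  have htot : ∫ ω, (P[g | G']) ω * (P[η | N']) ω ∂P = ∫ ω, g ω * η ω ∂P := by
    rw [(key _ _ (stronglyMeasurable_condExp.mono hG') (stronglyMeasurable_condExp.mono hN')
      integrable_condExp integrable_condExp).2, (key g η hg hη hgi hηi).2,
      integral_condExp (hG'.trans hG), integral_condExp (hN'.trans hN)]
  induction s, hs using MeasurableSpace.induction_on_inter hgen hpi with
  | empty => simp
  | basic t ht =>
    obtain ⟨A, B, hA, hB, rfl⟩ := ht
    rw [rect _ _ (stronglyMeasurable_condExp.mono hG') (stronglyMeasurable_condExp.mono hN')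
      integrable_condExp integrable_condExp A B hA hB, rect g η hg hη hgi hηi A B hA hB,
      setIntegral_condExp (hG'.trans hG) hgi hA, setIntegral_condExp (hN'.trans hN) hηi hB]
  | compl t ht ih =>
    have ih := ih (measure_lt_top _ _)
    rw [setIntegral_compl (hFm _ ht) hi2, setIntegral_compl (hFm _ ht) hi1, ih, htot]
  | iUnion f hd hf ih =>
    rw [integral_iUnion (fun i => hFm _ (hf i)) hd hi2.integrableOn,
      integral_iUnion (fun i => hFm _ (hf i)) hd hi1.integrableOn]
    exact tsum_congr fun i => ih i (measure_lt_top _ _)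

end CondExp

/-! ### Deterministic matrix inequalities. -/

section MatrixBounds

open Matrix

variable {m n : Type*} [Fintype m] [Fintype n]

/-- Subtracting `lambdaMin A` times the identity shifts the finite spectrum into the nonnegative
half-line, which makes the matrix positive semidefinite. -/
theorem lambdaMin_mul_le_dotProduct [DecidableEq m] {A : Matrix m m ℝ} (hA : A.IsHermitian)
    (d : m → ℝ) : lambdaMin A * (d ⬝ᵥ d) ≤ d ⬝ᵥ A *ᵥ d := by
  have hps : (A - algebraMap ℝ (Matrix m m ℝ) (lambdaMin A)).PosSemidef := by
    rw [posSemidef_iff_isHermitian_and_spectrum_nonneg]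
    refine ⟨hA.sub ?_, ?_⟩
    · rw [Matrix.IsHermitian, Matrix.algebraMap_eq_diagonal]
      simp
    · rw [← spectrum.sub_singleton_eq]
      rintro _ ⟨x, hx, y, hy, rfl⟩
      rw [Set.mem_singleton_iff] at hy
      subst hy
      simp only [Set.mem_ofPred_eq, sub_nonneg]
      exact csInf_le A.finite_real_spectrum.bddBelow hx
  have h := hps.dotProduct_mulVec_nonneg d
  rw [Matrix.sub_mulVec, dotProduct_sub, Algebra.algebraMap_eq_smul_one, Matrix.smul_mulVec,
    Matrix.one_mulVec, dotProduct_smul] at h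
  simpa using h

theorem abs_apply_le_specNorm [DecidableEq n] (A : Matrix m n ℝ) (r : m) (c : n) :
    |A r c| ≤ specNorm A := by
  have h := (Matrix.toEuclideanLin A).toContinuousLinearMap.le_opNorm (EuclideanSpace.single c 1)
  have h2 := PiLp.norm_apply_le
    ((Matrix.toEuclideanLin A).toContinuousLinearMap (EuclideanSpace.single c 1)) r
  refine le_trans (le_of_eq ?_) (h2.trans (h.trans (le_of_eq ?_)))
  · simp [Matrix.toEuclideanLin, Matrix.toLpLin_apply]
  · simp [specNorm]

/-- Cauchy–Schwarz in each row. The Frobenius norm is a polynomial in the entries, so its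
measurability is immediate. -/
theorem norm_toLp_mulVec_sq_le (A : Matrix m n ℝ) (d : EuclideanSpace ℝ n) :
    ‖(WithLp.toLp 2 (A *ᵥ d.ofLp) : EuclideanSpace ℝ m)‖ ^ 2
      ≤ (∑ r, ∑ c, A r c ^ 2) * ‖d‖ ^ 2 := by
  rw [EuclideanSpace.real_norm_sq_eq, EuclideanSpace.real_norm_sq_eq, Finset.sum_mul]
  exact Finset.sum_le_sum fun r _ => Finset.sum_mul_sq_le_sq_mul_sq _ _ _

end MatrixBounds

/-! ### Calculus of conditional upper bounds. -/

section CondLE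

variable {Ω : Type*} {mΩ : MeasurableSpace Ω} {P : Measure Ω}

/-- `Y` is integrable and its conditional expectation given `F` is almost surely at most `Z`. -/
def CondLE (P : Measure Ω) (F : MeasurableSpace Ω) (Y Z : Ω → ℝ) : Prop :=
  Integrable Y P ∧ ∀ᵐ ω ∂P, (P[Y | F]) ω ≤ Z ω

namespace CondLE

variable {F F' : MeasurableSpace Ω} {Y Y' Z Z' : Ω → ℝ}

theorem add (h : CondLE P F Y Z) (h' : CondLE P F Y' Z') :
    CondLE P F (fun ω => Y ω + Y' ω) (fun ω => Z ω + Z' ω) := by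
  refine ⟨h.1.add h'.1, ?_⟩
  filter_upwards [condExp_add h.1 h'.1 F, h.2, h'.2] with ω h1 h2 h3
  exact h1.le.trans (add_le_add h2 h3)

theorem const_mul (h : CondLE P F Y Z) {c : ℝ} (hc : 0 ≤ c) :
    CondLE P F (fun ω => c * Y ω) (fun ω => c * Z ω) := by
  refine ⟨h.1.const_mul c, ?_⟩
  filter_upwards [condExp_smul (μ := P) c Y F, h.2] with ω h1 h2
  exact h1.le.trans (mul_le_mul_of_nonneg_left h2 hc)

theorem mono_left (h : CondLE P F Y Z) (hi : Integrable Y' P) (hle : ∀ᵐ ω ∂P, Y' ω ≤ Y ω) :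
    CondLE P F Y' Z := by
  refine ⟨hi, ?_⟩
  filter_upwards [condExp_mono (m := F) hi h.1 hle, h.2] with ω h1 h2
  exact h1.trans h2

theorem mono_left_of_nonneg (h : CondLE P F Y Z) (hm : AEStronglyMeasurable[mΩ] Y' P)
    (h0 : ∀ ω, 0 ≤ Y' ω) (hle : ∀ᵐ ω ∂P, Y' ω ≤ Y ω) : CondLE P F Y' Z := by
  refine h.mono_left (h.1.mono' hm ?_) hle
  filter_upwards [hle] with ω hω
  rwa [Real.norm_of_nonneg (h0 ω)]

theorem mono_right (h : CondLE P F Y Z) (hle : ∀ᵐ ω ∂P, Z ω ≤ Z' ω) : CondLE P F Y Z' := by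
  refine ⟨h.1, ?_⟩
  filter_upwards [hle, h.2] with ω h1 h2
  exact h2.trans h1

variable [IsProbabilityMeasure P]

theorem self (hF : F ≤ mΩ) (hm : StronglyMeasurable[F] Y) (hi : Integrable Y P) :
    CondLE P F Y Y :=
  ⟨hi, by rw [condExp_of_stronglyMeasurable hF hm hi]; exact ae_of_all _ fun _ => le_rfl⟩

theorem trans (h : CondLE P F' Y Z) (h' : CondLE P F Z Z') (hFF' : F ≤ F') (hF' : F' ≤ mΩ) :
    CondLE P F Y Z' := by
  refine ⟨h.1, ?_⟩
  filter_upwards [condExp_le_of_condExp_le hFF' hF' h'.1 h.2, h'.2] with ω h1 h2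
  exact h1.trans h2

theorem mul_left {c : ℝ} (h : CondLE P F Y fun _ => c) (hF : F ≤ mΩ) (hY : ∀ ω, 0 ≤ Y ω)
    (hZ : StronglyMeasurable[F] Z) (hZ0 : ∀ ω, 0 ≤ Z ω) (hZi : Integrable Z P) :
    CondLE P F (fun ω => Y ω * Z ω) (fun ω => c * Z ω) := by
  simp_rw [mul_comm (Y _)]
  exact condExp_mul_le_of_condExp_le hF hZ hZ0 hZi hY h.1 h.2

end CondLE

end CondLE

/-! ### Abstract drift estimate for processes with small increments. -/

section Drift

variable {Ω : Type*} {mΩ : MeasurableSpace Ω} {E : Type*} [NormedAddCommGroup E]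

/-- An adapted process whose squared increments are at most `e k ^ 2 * R k * (1 + ‖δ k‖ ^ 2)`, with
`R k` of conditional mean at most `C` and a nonincreasing deterministic gain `e`. -/
structure GainBoundedProcess (P : Measure Ω) (F : ℕ → MeasurableSpace Ω) (δ : ℕ → Ω → E)
    (R : ℕ → Ω → ℝ) (e : ℕ → ℝ) (C : ℝ) : Prop where
  mono : Monotone F
  le : ∀ k, F k ≤ mΩ
  adapted : ∀ k, StronglyMeasurable[F k] (δ k)
  integrable_zero : Integrable (fun ω => ‖δ 0 ω‖ ^ 2) P
  R_nonneg : ∀ k ω, 0 ≤ R k ω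
  C_nonneg : 0 ≤ C
  R_condLE : ∀ k, CondLE P (F k) (R k) fun _ => C
  e_anti : Antitone e
  e_nonneg : ∀ k, 0 ≤ e k
  step : ∀ k, ∀ᵐ ω ∂P, ‖δ (k + 1) ω - δ k ω‖ ^ 2 ≤ e k ^ 2 * (R k ω * (1 + ‖δ k ω‖ ^ 2))

namespace GainBoundedProcess

variable {P : Measure Ω} {F : ℕ → MeasurableSpace Ω} {δ : ℕ → Ω → E}
  {R : ℕ → Ω → ℝ} {e : ℕ → ℝ} {C : ℝ} (G : GainBoundedProcess P F δ R e C)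

include G

theorem adapted_one_add (k : ℕ) : StronglyMeasurable[F k] fun ω => 1 + ‖δ k ω‖ ^ 2 :=
  stronglyMeasurable_const.add ((G.adapted k).norm.pow 2)

theorem e_sq_le {m k : ℕ} (h : m ≤ k) : e k ^ 2 ≤ e m ^ 2 :=
  pow_le_pow_left₀ (G.e_nonneg k) (G.e_anti h) 2

theorem adapted_norm_sub_sq (m j : ℕ) :
    StronglyMeasurable[F (m + j)] fun ω => ‖δ (m + j) ω - δ m ω‖ ^ 2 :=
  (((G.adapted _).sub ((G.adapted m).mono (G.mono (Nat.le_add_right m j)))).norm).pow 2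

variable [IsProbabilityMeasure P]

theorem condLE_R_mul {k : ℕ} (hi : Integrable (fun ω => 1 + ‖δ k ω‖ ^ 2) P) :
    CondLE P (F k) (fun ω => R k ω * (1 + ‖δ k ω‖ ^ 2)) (fun ω => C * (1 + ‖δ k ω‖ ^ 2)) :=
  (G.R_condLE k).mul_left (G.le k) (G.R_nonneg k) (G.adapted_one_add k) (fun ω => by positivity) hi

theorem integrable_one_add (k : ℕ) : Integrable (fun ω => 1 + ‖δ k ω‖ ^ 2) P := by
  induction k with
  | zero => exact (integrable_const _).add G.integrable_zero
  | succ k ih =>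
    have h := ((CondLE.self (G.le k) (G.adapted_one_add k) ih).const_mul (c := 2) (by norm_num)).add
      ((G.condLE_R_mul ih).const_mul (c := 2 * e k ^ 2) (by positivity))
    refine (h.mono_left_of_nonneg
      ((G.adapted_one_add (k + 1)).mono (G.le _)).aestronglyMeasurable
      (fun ω => by positivity) ?_).1
    filter_upwards [G.step k] with ω hω
    have h1 : ‖δ (k + 1) ω‖ ≤ ‖δ k ω‖ + ‖δ (k + 1) ω - δ k ω‖ := norm_le_norm_add_norm_sub' _ _
    have h2 : ‖δ (k + 1) ω‖ ^ 2 ≤ (‖δ k ω‖ + ‖δ (k + 1) ω - δ k ω‖) ^ 2 :=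
      pow_le_pow_left₀ (norm_nonneg _) h1 2
    nlinarith [sq_nonneg (‖δ k ω‖ - ‖δ (k + 1) ω - δ k ω‖)]

theorem integrable_norm_sq (k : ℕ) : Integrable (fun ω => ‖δ k ω‖ ^ 2) P := by
  refine ((G.integrable_one_add k).sub (integrable_const (1 : ℝ))).congr (ae_of_all _ fun ω => ?_)
  simp

theorem condLE_self_one_add (k : ℕ) :
    CondLE P (F k) (fun ω => 1 + ‖δ k ω‖ ^ 2) (fun ω => 1 + ‖δ k ω‖ ^ 2) :=
  CondLE.self (G.le k) (G.adapted_one_add k) (G.integrable_one_add k)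

/-- Each step costs at most the factor 2 + 2e(0)²C, so the constant depends on the number of steps
and not on the starting time. -/
theorem condLE_one_add (j : ℕ) : ∃ K : ℝ, 0 ≤ K ∧ ∀ m,
    CondLE P (F m) (fun ω => 1 + ‖δ (m + j) ω‖ ^ 2) (fun ω => K * (1 + ‖δ m ω‖ ^ 2)) := by
  induction j with
  | zero => exact ⟨1, zero_le_one, fun m => by simpa using G.condLE_self_one_add m⟩
  | succ j ih =>
    obtain ⟨K, hK, ih⟩ := ih
    have hC := G.C_nonneg
    refine ⟨(2 + 2 * e 0 ^ 2 * C) * K, by positivity, fun m => ?_⟩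
    set k := m + j with hk
    have h := ((G.condLE_self_one_add k).const_mul (c := 2) (by norm_num)).add
      ((G.condLE_R_mul (G.integrable_one_add k)).const_mul (c := 2 * e 0 ^ 2) (by positivity))
    have h' : CondLE P (F k) (fun ω => 1 + ‖δ (k + 1) ω‖ ^ 2)
        (fun ω => (2 + 2 * e 0 ^ 2 * C) * (1 + ‖δ k ω‖ ^ 2)) := by
      refine (h.mono_left (G.integrable_one_add (k + 1)) ?_).mono_right
        (ae_of_all _ fun ω => le_of_eq (by ring))
      filter_upwards [G.step k] with ω hω
      have h1 : ‖δ (k + 1) ω‖ ≤ ‖δ k ω‖ + ‖δ (k + 1) ω - δ k ω‖ := norm_le_norm_add_norm_sub' _ _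
      have h2 : ‖δ (k + 1) ω‖ ^ 2 ≤ (‖δ k ω‖ + ‖δ (k + 1) ω - δ k ω‖) ^ 2 :=
        pow_le_pow_left₀ (norm_nonneg _) h1 2
      have h3 := mul_le_mul_of_nonneg_right (G.e_sq_le k.zero_le)
        (mul_nonneg (G.R_nonneg k ω) (by positivity : 0 ≤ 1 + ‖δ k ω‖ ^ 2))
      nlinarith [sq_nonneg (‖δ k ω‖ - ‖δ (k + 1) ω - δ k ω‖)]
    refine (h'.trans ((ih m).const_mul (by positivity)) (G.mono (Nat.le_add_right m j))
      (G.le k)).mono_right (ae_of_all _ fun ω => le_of_eq (by ring))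

theorem condLE_R_mul_one_add (j : ℕ) : ∃ K : ℝ, 0 ≤ K ∧ ∀ m,
    CondLE P (F m) (fun ω => R (m + j) ω * (1 + ‖δ (m + j) ω‖ ^ 2))
      (fun ω => K * (1 + ‖δ m ω‖ ^ 2)) := by
  obtain ⟨K, hK, h⟩ := G.condLE_one_add j
  refine ⟨C * K, mul_nonneg G.C_nonneg hK, fun m => ?_⟩
  exact ((G.condLE_R_mul (G.integrable_one_add (m + j))).trans ((h m).const_mul G.C_nonneg)
    (G.mono (Nat.le_add_right m j)) (G.le _)).mono_right (ae_of_all _ fun ω => le_of_eq (by ring))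

/-- The increments add up, each carrying a gain no larger than `e m` by monotonicity; this smallness
makes freezing the vector a second-order error. -/
theorem condLE_norm_sub_sq (j : ℕ) : ∃ K : ℝ, 0 ≤ K ∧ ∀ m,
    CondLE P (F m) (fun ω => ‖δ (m + j) ω - δ m ω‖ ^ 2)
      (fun ω => K * (e m ^ 2 * (1 + ‖δ m ω‖ ^ 2))) := by
  induction j with
  | zero =>
    exact ⟨0, le_rfl, fun m => by
      simpa using CondLE.self (P := P) (G.le m) (stronglyMeasurable_const (b := (0 : ℝ)))
        (integrable_const _)⟩
  | succ j ih =>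
    obtain ⟨K, hK, ih⟩ := ih
    obtain ⟨L, hL, hR⟩ := G.condLE_R_mul_one_add j
    refine ⟨2 * K + 2 * L, by positivity, fun m => ?_⟩
    have h := ((ih m).const_mul (c := 2) (by norm_num)).add
      ((hR m).const_mul (c := 2 * e m ^ 2) (by positivity))
    refine (h.mono_left_of_nonneg ((G.adapted_norm_sub_sq m (j + 1)).mono
      (G.le _)).aestronglyMeasurable (fun ω => by positivity) ?_).mono_right
      (ae_of_all _ fun ω => le_of_eq (by ring))
    filter_upwards [G.step (m + j)] with ω hω
    have h1 : ‖δ (m + (j + 1)) ω - δ m ω‖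
        ≤ ‖δ (m + j + 1) ω - δ (m + j) ω‖ + ‖δ (m + j) ω - δ m ω‖ := norm_sub_le_norm_sub_add_norm_sub _ _ _
    have h2 := pow_le_pow_left₀ (norm_nonneg _) h1 2
    have h3 := mul_le_mul_of_nonneg_right (G.e_sq_le (Nat.le_add_right m j))
      (mul_nonneg (G.R_nonneg (m + j) ω) (by positivity : 0 ≤ 1 + ‖δ (m + j) ω‖ ^ 2))
    nlinarith [sq_nonneg (‖δ (m + j + 1) ω - δ (m + j) ω‖ - ‖δ (m + j) ω - δ m ω‖)]

/-- Drift of the squared norm over `h` steps: the quadratic terms `Q i (δ i)` may be replaced by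
`Q i (δ m)`, evaluated at the starting time, up to an error of second order in the gains. -/
theorem condLE_drift {Q : ℕ → Ω → E → ℝ} {ζ : ℕ → Ω → ℝ} {l : ℕ → ℝ} (hl : Antitone l)
    (hl0 : ∀ k, 0 ≤ l k)
    (hζ : ∀ k, CondLE P (F k) (ζ k) fun _ => 0)
    (hQi : ∀ m j, Integrable (fun ω => Q (m + j) ω (δ m ω)) P)
    (hQ : ∀ k, ∀ᵐ ω ∂P, ∀ d d', |Q k ω d - Q k ω d'| ≤ e k * (R k ω * (‖d - d'‖ * (‖d‖ + ‖d'‖))))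
    (hV : ∀ k, ∀ᵐ ω ∂P, ‖δ (k + 1) ω‖ ^ 2 ≤ ‖δ k ω‖ ^ 2 - 2 * Q k ω (δ k ω) + 2 * ζ k ω
      + (e k ^ 2 + l k) * (R k ω * (1 + ‖δ k ω‖ ^ 2))) (h : ℕ) :
    ∃ K : ℝ, 0 ≤ K ∧ ∀ m,
      CondLE P (F m) (fun ω => ‖δ (m + h) ω‖ ^ 2 + 2 * ∑ j ∈ Finset.range h, Q (m + j) ω (δ m ω))
        (fun ω => ‖δ m ω‖ ^ 2 + K * ((e m ^ 2 + l m) * (1 + ‖δ m ω‖ ^ 2))) := by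
  induction h with
  | zero =>
    refine ⟨0, le_rfl, fun m => ?_⟩
    have h0 : StronglyMeasurable[F m] fun ω => ‖δ m ω‖ ^ 2 := (G.adapted m).norm.pow 2
    simpa using CondLE.self (P := P) (G.le m) h0 (G.integrable_norm_sq m)
  | succ h ih =>
    obtain ⟨K, hK, ih⟩ := ih
    obtain ⟨L, hL, hR⟩ := G.condLE_R_mul_one_add h
    obtain ⟨D, hD, hd⟩ := G.condLE_norm_sub_sq h
    have hC := G.C_nonneg
    have he0 := G.e_nonneg 0
    -- `K` is the error of the first `h` steps, `L` the one-step remainder at time `m + h`, and the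
    -- last term the cost of freezing `Q` at `δ m`.
    refine ⟨K + L + 2 * (1 + e 0) * C * (D + 1), by positivity, fun m => ?_⟩
    have hmj : m ≤ m + h := Nat.le_add_right m h
    have hYi : Integrable (fun ω => ‖δ (m + h) ω - δ m ω‖ ^ 2 + e m ^ 2 * (1 + ‖δ m ω‖ ^ 2)) P :=
      (hd m).1.add ((G.integrable_one_add m).const_mul _)
    have hRY : CondLE P (F (m + h))
        (fun ω => R (m + h) ω * (‖δ (m + h) ω - δ m ω‖ ^ 2 + e m ^ 2 * (1 + ‖δ m ω‖ ^ 2)))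
        (fun ω => C * (‖δ (m + h) ω - δ m ω‖ ^ 2 + e m ^ 2 * (1 + ‖δ m ω‖ ^ 2))) :=
      (G.R_condLE (m + h)).mul_left (G.le _) (G.R_nonneg _)
        ((G.adapted_norm_sub_sq m h).add
          (((G.adapted_one_add m).mono (G.mono hmj)).const_mul _))
        (fun ω => by positivity) hYi
    have hRY' := hRY.trans (((hd m).add ((G.condLE_self_one_add m).const_mul
      (sq_nonneg (e m)))).const_mul hC) (G.mono hmj) (G.le _)
    have hζ' : CondLE P (F m) (ζ (m + h)) fun _ => 0 := by
      refine (hζ (m + h)).trans (CondLE.self (G.le m) stronglyMeasurable_const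
        (integrable_const _)) (G.mono hmj) (G.le _)
    have hsum := (((ih m).add (hζ'.const_mul (c := 2) (by norm_num))).add
      ((hR m).const_mul (add_nonneg (sq_nonneg (e m)) (hl0 m)))).add
      (hRY'.const_mul (c := 2 * (1 + e 0)) (by positivity))
    refine (hsum.mono_left ?_ ?_).mono_right ?_
    · refine (G.integrable_norm_sq _).add (Integrable.const_mul ?_ _)
      exact integrable_finsetSum _ fun j _ => hQi m j
    · filter_upwards [hQ (m + h), hV (m + h)] with ω hQ hV
      have h1 := (abs_le.1 (hQ (δ (m + h) ω) (δ m ω))).1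
      rw [Finset.sum_range_succ]
      have hX : 0 ≤ R (m + h) ω * (1 + ‖δ (m + h) ω‖ ^ 2) :=
        mul_nonneg (G.R_nonneg _ ω) (by positivity)
      have h2 := mul_le_mul_of_nonneg_right (add_le_add (G.e_sq_le hmj) (hl hmj)) hX
      -- With x the displacement and y = ‖δ m‖, the cross term 2x(e y) is split by AM–GM into x² +
      -- e²y², both of second order after conditioning.
      have h3 : e (m + h) * (‖δ (m + h) ω - δ m ω‖ * (‖δ (m + h) ω‖ + ‖δ m ω‖))
          ≤ (1 + e 0) * (‖δ (m + h) ω - δ m ω‖ ^ 2 + e m ^ 2 * (1 + ‖δ m ω‖ ^ 2)) := by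
        have hem := G.e_nonneg m
        have hem0 := G.e_anti (Nat.zero_le m)
        have hn : ‖δ (m + h) ω‖ ≤ ‖δ m ω‖ + ‖δ (m + h) ω - δ m ω‖ := norm_le_norm_add_norm_sub' _ _
        set x := ‖δ (m + h) ω - δ m ω‖
        set y := ‖δ m ω‖
        have hx : 0 ≤ x := norm_nonneg _
        have hy : 0 ≤ y := norm_nonneg _
        calc e (m + h) * (x * (‖δ (m + h) ω‖ + y)) ≤ e m * (x * (y + x + y)) := by
              have := G.e_anti hmj
              gcongr
          _ = e m * x ^ 2 + 2 * x * (e m * y) := by ring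
          _ ≤ e 0 * x ^ 2 + (x ^ 2 + (e m * y) ^ 2) := by
              gcongr
              nlinarith [sq_nonneg (x - e m * y)]
          _ ≤ _ := by
              have : 0 ≤ e 0 * (e m ^ 2 * (1 + y ^ 2)) := by positivity
              nlinarith [sq_nonneg (e m)]
      have h4 := mul_le_mul_of_nonneg_left h3 (G.R_nonneg (m + h) ω)
      have h5 : e (m + h) * (R (m + h) ω *
          (‖δ (m + h) ω - δ m ω‖ * (‖δ (m + h) ω‖ + ‖δ m ω‖))) =
          R (m + h) ω * (e (m + h) * (‖δ (m + h) ω - δ m ω‖ * (‖δ (m + h) ω‖ + ‖δ m ω‖))) := by ring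
      rw [h5] at h1
      rw [← add_assoc m h 1]
      linarith
    · filter_upwards with ω
      have h6 : 0 ≤ l m * (2 * (1 + e 0) * C * (D + 1) * (1 + ‖δ m ω‖ ^ 2)) :=
        mul_nonneg (hl0 m) (by positivity)
      nlinarith

end GainBoundedProcess

end Drift

/-! ### The error recursion. -/

namespace RegressionNetwork

open Matrix

section Recursion

variable {Ω : Type*} [MeasurableSpace Ω] {N n : ℕ} (S : RegressionNetwork Ω N n)

/-- Squared Frobenius norm of the stacked regression matrix. -/
def frobSq (k : ℕ) (ω : Ω) : ℝ := ∑ r, ∑ c, S.HBlock k ω r c ^ 2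

/-- Squared norm of all the noises at time `k`. -/
noncomputable def noiseSq (k : ℕ) (ω : Ω) : ℝ := ‖S.vStack k ω‖ ^ 2 + ‖S.ξStack k ω‖ ^ 2

/-- The vector `1_N ⊗ x₀`. -/
noncomputable def x₀Stack : EuclideanSpace ℝ (Fin N × Fin n) := WithLp.toLp 2 fun p => S.x₀ p.2

/-- Contribution of the measurement noises to the error. -/
noncomputable def measNoise (k : ℕ) (ω : Ω) : EuclideanSpace ℝ (Fin N × Fin n) :=
  WithLp.toLp 2 ((S.HBlock k ω)ᵀ *ᵥ (S.vStack k ω).ofLp)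

/-- Contribution of the communication noises to the error. -/
noncomputable def commNoise (k : ℕ) (ω : Ω) : EuclideanSpace ℝ (Fin N × Fin n) :=
  WithLp.toLp 2 fun p => ∑ j, S.A k ω p.1 j *
    (S.f j p.1 (S.x k ω j - S.x k ω p.1) * S.ξ j p.1 k ω p.2)

/-- `b(k) L ⊗ I + a(k) 𝓗(k)ᵀ 𝓗(k)` for an arbitrary matrix `L` in place of the Laplacian. -/
noncomputable def gainMat (k : ℕ) (L : Matrix (Fin N) (Fin N) ℝ) (ω : Ω) :
    Matrix (Fin N × Fin n) (Fin N × Fin n) ℝ :=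
  S.b k • (L ⊗ₖ (1 : Matrix (Fin n) (Fin n) ℝ)) + S.a k • S.gram k ω

theorem frobSq_nonneg (k : ℕ) (ω : Ω) : 0 ≤ S.frobSq k ω :=
  Finset.sum_nonneg fun _ _ => Finset.sum_nonneg fun _ _ => sq_nonneg _

theorem noiseSq_nonneg (k : ℕ) (ω : Ω) : 0 ≤ S.noiseSq k ω := by
  unfold noiseSq; positivity

theorem transpose_HBlock_mulVec_apply (k : ℕ) (ω : Ω) (u : (Σ i, Fin (S.dim i)) → ℝ)
    (p : Fin N × Fin n) :
    ((S.HBlock k ω)ᵀ *ᵥ u) p = ∑ r, S.H p.1 k ω r p.2 * u ⟨p.1, r⟩ := by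
  simp only [mulVec, dotProduct, transpose_apply, HBlock, of_apply, Fintype.sum_sigma, ite_mul,
    zero_mul]
  rw [Finset.sum_eq_single p.1 (fun j _ hj => by simp [hj]) (by simp)]
  simp

theorem HBlock_mulVec_apply (k : ℕ) (ω : Ω) (d : Fin N × Fin n → ℝ) (r : Σ i, Fin (S.dim i)) :
    (S.HBlock k ω *ᵥ d) r = ∑ c, S.H r.1 k ω r.2 c * d (r.1, c) := by
  simp only [mulVec, dotProduct, HBlock, of_apply, Fintype.sum_prod_type, ite_mul, zero_mul]
  rw [Finset.sum_eq_single r.1 (fun j _ hj => by simp [Ne.symm hj]) (by simp)]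
  simp

theorem kronecker_one_mulVec_apply (L : Matrix (Fin N) (Fin N) ℝ) (d : Fin N × Fin n → ℝ)
    (p : Fin N × Fin n) :
    ((L ⊗ₖ (1 : Matrix (Fin n) (Fin n) ℝ)) *ᵥ d) p = ∑ j, L p.1 j * d (j, p.2) := by
  simp [mulVec, dotProduct, Fintype.sum_prod_type, Matrix.one_apply]

theorem gainMat_mulVec_apply (k : ℕ) (L : Matrix (Fin N) (Fin N) ℝ) (ω : Ω)
    (d : Fin N × Fin n → ℝ) (p : Fin N × Fin n) :
    (S.gainMat k L ω *ᵥ d) p = S.b k * ∑ j, L p.1 j * d (j, p.2) +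
      S.a k * ∑ r, S.H p.1 k ω r p.2 * ∑ c, S.H p.1 k ω r c * d (p.1, c) := by
  simp only [gainMat, gram, add_mulVec, smul_mulVec, ← mulVec_mulVec, Pi.add_apply, Pi.smul_apply,
    smul_eq_mul, kronecker_one_mulVec_apply, transpose_HBlock_mulVec_apply, HBlock_mulVec_apply]

theorem x_succ_apply (k : ℕ) (ω : Ω) (i : Fin N) (c : Fin n) :
    S.x (k + 1) ω i c = S.x k ω i c
      + S.a k * ∑ r, S.H i k ω r c * (∑ c', S.H i k ω r c' * S.x₀ c' + S.v i k ω r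
          - ∑ c', S.H i k ω r c' * S.x k ω i c')
      + S.b k * ∑ j, S.A k ω i j * (S.x k ω j c
          + S.f j i (S.x k ω j - S.x k ω i) * S.ξ j i k ω c - S.x k ω i c)
      - S.lam k * S.x k ω i c := by
  -- Non-neighbours have weight zero, so the random index set may be replaced by all nodes.
  have hn : ∑ j ∈ S.nbr k ω i, S.A k ω i j •
      (S.x k ω j + S.f j i (S.x k ω j - S.x k ω i) • S.ξ j i k ω - S.x k ω i)
      = ∑ j, S.A k ω i j •
      (S.x k ω j + S.f j i (S.x k ω j - S.x k ω i) • S.ξ j i k ω - S.x k ω i) := by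
    refine Finset.sum_subset (Finset.subset_univ _) fun j _ hj => ?_
    have : S.A k ω i j = 0 := by simpa [nbr] using hj
    rw [this, zero_smul]
  rw [x, hn]
  simp [y, Matrix.toLpLin_apply, mulVec, dotProduct]

theorem δ_succ (k : ℕ) (ω : Ω) :
    S.δ (k + 1) ω - S.δ k ω =
      -(toEuclideanLin (S.gainMat k (S.lap k ω) ω) (S.δ k ω)
        + S.lam k • (S.δ k ω + S.x₀Stack))
      + (S.a k • S.measNoise k ω + S.b k • S.commNoise k ω) := by
  ext p
  -- The rows of a Laplacian sum to zero, so x₀ drops out and only differences between nodes remain.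
  have hlap : ∑ j, S.lap k ω p.1 j * (S.x k ω j p.2 - S.x₀ p.2) =
      -∑ j, S.A k ω p.1 j * (S.x k ω j p.2 - S.x k ω p.1 p.2) := by
    simp only [lap, Matrix.sub_apply, sub_mul, Finset.sum_sub_distrib, diagonal_apply, ite_mul, zero_mul,
      Finset.sum_ite_eq, Finset.mem_univ, if_true, mul_sub, Finset.sum_mul]
    ring
  have hcomm : ∑ j, S.A k ω p.1 j * (S.x k ω j p.2
          + S.f j p.1 (S.x k ω j - S.x k ω p.1) * S.ξ j p.1 k ω p.2 - S.x k ω p.1 p.2) =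
      ∑ j, S.A k ω p.1 j * (S.x k ω j p.2 - S.x k ω p.1 p.2) +
      ∑ j, S.A k ω p.1 j * (S.f j p.1 (S.x k ω j - S.x k ω p.1) * S.ξ j p.1 k ω p.2) := by
    rw [← Finset.sum_add_distrib]
    exact Finset.sum_congr rfl fun j _ => by ring
  have hmeas : ∑ r, S.H p.1 k ω r p.2 * (∑ c', S.H p.1 k ω r c' * S.x₀ c' + S.v p.1 k ω r
          - ∑ c', S.H p.1 k ω r c' * S.x k ω p.1 c') =
      ∑ r, S.H p.1 k ω r p.2 * S.v p.1 k ω r -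
      ∑ r, S.H p.1 k ω r p.2 * ∑ c', S.H p.1 k ω r c' * (S.x k ω p.1 c' - S.x₀ c') := by
    rw [← Finset.sum_sub_distrib]
    refine Finset.sum_congr rfl fun r _ => ?_
    simp only [mul_sub, Finset.sum_sub_distrib]
    ring
  simp only [PiLp.sub_apply, PiLp.add_apply, PiLp.neg_apply, PiLp.smul_apply, smul_eq_mul, δ,
    Matrix.toLpLin_apply, gainMat_mulVec_apply, measNoise, commNoise,
    transpose_HBlock_mulVec_apply, vStack, x₀Stack, x_succ_apply, hlap, hcomm, hmeas]
  ring

/-- A quadratic form sees only the symmetric part. This is how the symmetrized Laplacian enters. -/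
theorem inner_gainMat (k : ℕ) (L : Matrix (Fin N) (Fin N) ℝ) (ω : Ω)
    (d : EuclideanSpace ℝ (Fin N × Fin n)) :
    inner ℝ d (toEuclideanLin (S.gainMat k L ω) d) =
      inner ℝ d (toEuclideanLin (S.gainMat k ((1 / 2 : ℝ) • (L + Lᵀ)) ω) d) := by
  have h : ∀ L' : Matrix (Fin N) (Fin N) ℝ,
      inner ℝ d (toEuclideanLin (S.gainMat k L' ω) d) = S.b k * ∑ c, ∑ i, ∑ j,
        d (i, c) * (L' i j * d (j, c)) + S.a k * (d.ofLp ⬝ᵥ S.gram k ω *ᵥ d.ofLp) := by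
    intro L'
    rw [EuclideanSpace.inner_eq_star_dotProduct, dotProduct_comm]
    simp only [star_trivial, Matrix.toLpLin_apply, gainMat, add_mulVec, smul_mulVec,
      dotProduct_add, dotProduct_smul, smul_eq_mul]
    congr 2
    simp only [dotProduct, kronecker_one_mulVec_apply, Fintype.sum_prod_type, Finset.mul_sum]
    exact Finset.sum_comm
  rw [h, h]
  congr 3
  ext c
  have hsw : ∑ i, ∑ j, d (i, c) * (L i j * d (j, c)) = ∑ i, ∑ j, d (i, c) * (L j i * d (j, c)) := by
    rw [Finset.sum_comm]
    exact Finset.sum_congr rfl fun i _ => Finset.sum_congr rfl fun j _ => by ring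
  have : ∑ i, ∑ j, d (i, c) * (((1 / 2 : ℝ) • (L + Lᵀ)) i j * d (j, c)) =
      (1 / 2) * (∑ i, ∑ j, d (i, c) * (L i j * d (j, c))) +
      (1 / 2) * ∑ i, ∑ j, d (i, c) * (L j i * d (j, c)) := by
    simp only [Finset.mul_sum, ← Finset.sum_add_distrib]
    refine Finset.sum_congr rfl fun i _ => Finset.sum_congr rfl fun j _ => ?_
    simp only [Matrix.smul_apply, Matrix.add_apply, transpose_apply, smul_eq_mul]
    ring
  rw [this, ← hsw]
  ring

end Recursion

end RegressionNetwork

/-! ### Pathwise bounds for one step. -/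

namespace RegressionNetwork

open Matrix

section Bounds

variable {Ω : Type*} [MeasurableSpace Ω] {N n : ℕ} (S : RegressionNetwork Ω N n)

/-- Sum of the gains at time `k`. -/
def gainSum (k : ℕ) : ℝ := S.a k + S.b k + S.lam k

theorem norm_toLp_mulVec_le_of_sq {m n : Type*} [Fintype m] [Fintype n] (A : Matrix m n ℝ)
    {t : ℝ} (ht : 0 ≤ t) (hA : ∑ r, ∑ c, A r c ^ 2 ≤ t ^ 2) (d : EuclideanSpace ℝ n) :
    ‖(WithLp.toLp 2 (A *ᵥ d.ofLp) : EuclideanSpace ℝ m)‖ ≤ t * ‖d‖ := by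
  refine le_of_sq_le_sq ?_ (by positivity)
  rw [mul_pow]
  exact (norm_toLp_mulVec_sq_le A d).trans (mul_le_mul_of_nonneg_right hA (sq_nonneg _))

theorem norm_measNoise_sq_le (k : ℕ) (ω : Ω) :
    ‖S.measNoise k ω‖ ^ 2 ≤ S.frobSq k ω * ‖S.vStack k ω‖ ^ 2 := by
  refine (norm_toLp_mulVec_sq_le _ _).trans (le_of_eq ?_)
  rw [frobSq, Finset.sum_comm]
  rfl

theorem norm_gram_mulVec_le (k : ℕ) (ω : Ω) (d : EuclideanSpace ℝ (Fin N × Fin n)) :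
    ‖(WithLp.toLp 2 (S.gram k ω *ᵥ d.ofLp) : EuclideanSpace ℝ (Fin N × Fin n))‖
      ≤ S.frobSq k ω * ‖d‖ := by
  have hf := S.frobSq_nonneg k ω
  refine le_of_sq_le_sq ?_ (by positivity)
  rw [gram, ← mulVec_mulVec]
  refine (norm_toLp_mulVec_sq_le _ (WithLp.toLp 2 (S.HBlock k ω *ᵥ d.ofLp))).trans ?_
  have h1 : ∑ r, ∑ c, (S.HBlock k ω)ᵀ r c ^ 2 = S.frobSq k ω := by
    rw [frobSq, Finset.sum_comm]; rfl
  rw [h1, mul_pow, sq (S.frobSq k ω), mul_assoc]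
  exact mul_le_mul_of_nonneg_left (norm_toLp_mulVec_sq_le _ d) hf

theorem norm_gainMat_le {k : ℕ} {L : Matrix (Fin N) (Fin N) ℝ} {ω : Ω} {ρ : ℝ} (hρ : 0 ≤ ρ)
    (hL : ∀ i j, |L i j| ≤ ρ) (ha : 0 ≤ S.a k) (hb : 0 ≤ S.b k) (hl : 0 ≤ S.lam k)
    (d : EuclideanSpace ℝ (Fin N × Fin n)) :
    ‖toEuclideanLin (S.gainMat k L ω) d‖
      ≤ S.gainSum k * ((N * n * ρ + S.frobSq k ω) * ‖d‖) := by
  have hf := S.frobSq_nonneg k ω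
  have h1 : toEuclideanLin (S.gainMat k L ω) d =
      S.b k • (WithLp.toLp 2 ((L ⊗ₖ (1 : Matrix (Fin n) (Fin n) ℝ)) *ᵥ d.ofLp)) +
      S.a k • (WithLp.toLp 2 (S.gram k ω *ᵥ d.ofLp)) := by
    ext p
    simp [gainMat, Matrix.toLpLin_apply]
  have h2 : ‖(WithLp.toLp 2 ((L ⊗ₖ (1 : Matrix (Fin n) (Fin n) ℝ)) *ᵥ d.ofLp) :
      EuclideanSpace ℝ (Fin N × Fin n))‖ ≤ N * n * ρ * ‖d‖ := by
    refine norm_toLp_mulVec_le_of_sq _ (by positivity) ?_ d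
    -- There are (Nn)² entries of size at most ρ, whence the Frobenius bound Nnρ.
    have hent : ∀ r c : Fin N × Fin n, (L ⊗ₖ (1 : Matrix (Fin n) (Fin n) ℝ)) r c ^ 2 ≤ ρ ^ 2 := by
      intro r c
      rw [kroneckerMap_apply, Matrix.one_apply]
      split_ifs
      · rw [mul_one]; exact sq_le_sq' (abs_le.1 (hL _ _)).1 (abs_le.1 (hL _ _)).2
      · simp; positivity
    refine (Finset.sum_le_sum fun r _ => Finset.sum_le_sum fun c _ => hent r c).trans
      (le_of_eq ?_)
    simp
    ring
  rw [h1]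
  refine (norm_add_le _ _).trans ?_
  rw [norm_smul, norm_smul, Real.norm_of_nonneg ha, Real.norm_of_nonneg hb, gainSum]
  have h3 := mul_le_mul_of_nonneg_left h2 hb
  have h4 := mul_le_mul_of_nonneg_left (S.norm_gram_mulVec_le k ω d) ha
  have h5 : 0 ≤ (S.a k + S.lam k) * (N * n * ρ * ‖d‖) := by positivity
  have h6 : 0 ≤ (S.b k + S.lam k) * (S.frobSq k ω * ‖d‖) := by positivity
  linarith

theorem abs_inner_gainMat_sub_le {k : ℕ} {L : Matrix (Fin N) (Fin N) ℝ} {ω : Ω} {ρ : ℝ}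
    (hρ : 0 ≤ ρ) (hL : ∀ i j, |L i j| ≤ ρ) (ha : 0 ≤ S.a k) (hb : 0 ≤ S.b k) (hl : 0 ≤ S.lam k)
    (d d' : EuclideanSpace ℝ (Fin N × Fin n)) :
    |inner ℝ d (toEuclideanLin (S.gainMat k L ω) d)
        - inner ℝ d' (toEuclideanLin (S.gainMat k L ω) d')|
      ≤ S.gainSum k * ((N * n * ρ + S.frobSq k ω) * (‖d - d'‖ * (‖d‖ + ‖d'‖))) := by
  set B := toEuclideanLin (S.gainMat k L ω)
  have h1 : inner ℝ d (B d) - inner ℝ d' (B d') = inner ℝ (d - d') (B d) + inner ℝ d' (B (d - d')) := by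
    rw [map_sub, inner_sub_left, inner_sub_right]; ring
  rw [h1]
  refine (abs_add_le _ _).trans ?_
  have h2 := (abs_real_inner_le_norm (d - d') (B d)).trans
    (mul_le_mul_of_nonneg_left (S.norm_gainMat_le hρ hL ha hb hl d) (norm_nonneg _))
  have h3 := (abs_real_inner_le_norm d' (B (d - d'))).trans
    (mul_le_mul_of_nonneg_left (S.norm_gainMat_le hρ hL ha hb hl (d - d')) (norm_nonneg _))
  refine (add_le_add h2 h3).trans (le_of_eq ?_)
  ring

theorem norm_x_sub_le (k : ℕ) (ω : Ω) (i j : Fin N) :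
    ‖S.x k ω j - S.x k ω i‖ ≤ 2 * ‖S.δ k ω‖ := by
  have h : ∀ i, ‖S.x k ω i - S.x₀‖ ≤ ‖S.δ k ω‖ := by
    intro i
    refine le_of_sq_le_sq ?_ (norm_nonneg _)
    rw [EuclideanSpace.real_norm_sq_eq, EuclideanSpace.real_norm_sq_eq, Fintype.sum_prod_type]
    exact Finset.single_le_sum (f := fun i => ∑ c, (S.δ k ω) (i, c) ^ 2)
      (fun _ _ => Finset.sum_nonneg fun _ _ => sq_nonneg _) (Finset.mem_univ i)
  calc ‖S.x k ω j - S.x k ω i‖ = ‖(S.x k ω j - S.x₀) - (S.x k ω i - S.x₀)‖ := by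
        rw [sub_sub_sub_cancel_right]
    _ ≤ _ := norm_sub_le _ _
    _ ≤ _ := by linarith [h i, h j]

/-- Two estimates differ by at most 2‖δ‖, so (2|σ|‖δ‖ + |c|)² ≤ 8σ²‖δ‖² + 2c². The noise intensity
thus grows no faster than the error itself. -/
theorem f_sq_le {σ c : ℝ} (hf : ∀ j i z, |S.f j i z| ≤ σ * ‖z‖ + c) (k : ℕ) (ω : Ω)
    (i j : Fin N) :
    S.f j i (S.x k ω j - S.x k ω i) ^ 2 ≤ (8 * σ ^ 2 + 2 * c ^ 2) * (1 + ‖S.δ k ω‖ ^ 2) := by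
  have h1 : |S.f j i (S.x k ω j - S.x k ω i)| ≤ |σ| * (2 * ‖S.δ k ω‖) + |c| :=
    (hf j i _).trans (add_le_add ((mul_le_mul_of_nonneg_right (le_abs_self σ) (norm_nonneg _)).trans
      (mul_le_mul_of_nonneg_left (S.norm_x_sub_le k ω i j) (abs_nonneg σ))) (le_abs_self c))
  rw [← sq_abs]
  refine (pow_le_pow_left₀ (abs_nonneg _) h1 2).trans ?_
  rw [← sq_abs σ, ← sq_abs c]
  nlinarith [sq_nonneg (|σ| * (2 * ‖S.δ k ω‖) - |c|), sq_nonneg (|c| * ‖S.δ k ω‖), sq_nonneg |σ|]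

theorem norm_commNoise_sq_le {σ c ρ : ℝ} (hf : ∀ j i z, |S.f j i z| ≤ σ * ‖z‖ + c) {k : ℕ} {ω : Ω}
    (hA : ∀ i j, |S.A k ω i j| ≤ ρ) :
    ‖S.commNoise k ω‖ ^ 2 ≤ N * ρ ^ 2 * (8 * σ ^ 2 + 2 * c ^ 2) *
      ((1 + ‖S.δ k ω‖ ^ 2) * ‖S.ξStack k ω‖ ^ 2) := by
  set K := (8 * σ ^ 2 + 2 * c ^ 2) * (1 + ‖S.δ k ω‖ ^ 2) with hK
  have hent : ∀ p : Fin N × Fin n, S.commNoise k ω p ^ 2 ≤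
      N * ∑ j, ρ ^ 2 * K * S.ξ j p.1 k ω p.2 ^ 2 := by
    intro p
    have := sq_sum_le_card_mul_sum_sq (s := (Finset.univ : Finset (Fin N)))
      (f := fun j => S.A k ω p.1 j * (S.f j p.1 (S.x k ω j - S.x k ω p.1) * S.ξ j p.1 k ω p.2))
    rw [Finset.card_univ, Fintype.card_fin] at this
    refine this.trans (mul_le_mul_of_nonneg_left (Finset.sum_le_sum fun j _ => ?_) N.cast_nonneg)
    rw [mul_pow, mul_pow, ← mul_assoc]
    refine mul_le_mul_of_nonneg_right (mul_le_mul ?_ (S.f_sq_le hf k ω p.1 j) (sq_nonneg _)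
      (sq_nonneg _)) (sq_nonneg _)
    exact sq_le_sq' (abs_le.1 (hA _ _)).1 (abs_le.1 (hA _ _)).2
  rw [EuclideanSpace.real_norm_sq_eq (S.commNoise k ω)]
  refine (Finset.sum_le_sum fun p _ => hent p).trans (le_of_eq ?_)
  rw [EuclideanSpace.real_norm_sq_eq (S.ξStack k ω)]
  have h2 : ∑ q : Fin N × Fin N × Fin n, S.ξStack k ω q ^ 2 =
      ∑ p : Fin N × Fin n, ∑ j, S.ξ j p.1 k ω p.2 ^ 2 := by
    simp only [Fintype.sum_prod_type, ξStack]
    exact Finset.sum_congr rfl fun i _ => Finset.sum_comm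
  rw [h2, ← Finset.mul_sum]
  simp_rw [← Finset.mul_sum]
  rw [hK]
  ring

/-- Inner product of the error with the noise entering the next step. -/
noncomputable def noiseInner (k : ℕ) (ω : Ω) : ℝ :=
  S.a k * inner ℝ (S.δ k ω) (S.measNoise k ω) + S.b k * inner ℝ (S.δ k ω) (S.commNoise k ω)

/-- Random factor controlling one step of the algorithm. -/
noncomputable def stepFactor (M : ℝ) (k : ℕ) (ω : Ω) : ℝ :=
  M * (1 + S.frobSq k ω ^ 2 + (1 + S.frobSq k ω) * S.noiseSq k ω)

theorem norm_add_sq_le_two_mul {E : Type*} [SeminormedAddCommGroup E] (u v : E) :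
    ‖u + v‖ ^ 2 ≤ 2 * ‖u‖ ^ 2 + 2 * ‖v‖ ^ 2 := by
  refine (pow_le_pow_left₀ (norm_nonneg _) (norm_add_le u v) 2).trans ?_
  linarith [two_mul_le_add_sq ‖u‖ ‖v‖, add_sq ‖u‖ ‖v‖]

theorem norm_gainMat_add_sq_le {k : ℕ} {ω : Ω} {ρ : ℝ} (hρ : 0 ≤ ρ)
    (hL : ∀ i j, |S.lap k ω i j| ≤ ρ) (ha : 0 ≤ S.a k) (hb : 0 ≤ S.b k) (hl : 0 ≤ S.lam k) :
    ‖toEuclideanLin (S.gainMat k (S.lap k ω) ω) (S.δ k ω) + S.lam k • (S.δ k ω + S.x₀Stack)‖ ^ 2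
      ≤ S.gainSum k ^ 2 * ((4 * (N * n * ρ + 1 + ‖S.x₀Stack‖) ^ 2 + 4 * S.frobSq k ω ^ 2)
        * (1 + ‖S.δ k ω‖ ^ 2)) := by
  have ht := S.frobSq_nonneg k ω
  have hNn : 0 ≤ N * n * ρ := by positivity
  have he0 : 0 ≤ S.gainSum k := by rw [gainSum]; positivity
  have hle : S.lam k ≤ S.gainSum k := by rw [gainSum]; linarith
  have h1 := S.norm_gainMat_le (ω := ω) hρ hL ha hb hl (S.δ k ω)
  have h2 : ‖S.lam k • (S.δ k ω + S.x₀Stack)‖ ≤ S.gainSum k * (‖S.δ k ω‖ + ‖S.x₀Stack‖) := by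
    rw [norm_smul, Real.norm_of_nonneg hl]
    exact mul_le_mul hle (norm_add_le _ _) (norm_nonneg _) he0
  have h3 := (norm_add_le _ _).trans (add_le_add h1 h2)
  have hd := norm_nonneg (S.δ k ω)
  have hκ := norm_nonneg S.x₀Stack
  generalize ‖S.δ k ω‖ = d at *
  generalize ‖S.x₀Stack‖ = κ at *
  generalize S.frobSq k ω = t at *
  generalize N * n * ρ = q at *
  have h4 : S.gainSum k * ((q + t) * d) + S.gainSum k * (d + κ)
      ≤ S.gainSum k * ((q + 1 + κ + t) * (1 + d)) := by
    rw [← mul_add]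
    refine mul_le_mul_of_nonneg_left ?_ he0
    have : 0 ≤ κ * d := by positivity
    linarith
  refine (pow_le_pow_left₀ (norm_nonneg _) (h3.trans h4) 2).trans ?_
  rw [mul_pow]
  refine mul_le_mul_of_nonneg_left ?_ (sq_nonneg _)
  rw [mul_pow]
  have h5 : (q + 1 + κ + t) ^ 2 ≤ 2 * (q + 1 + κ) ^ 2 + 2 * t ^ 2 := by
    nlinarith [sq_nonneg (q + 1 + κ - t)]
  have h6 : (1 + d) ^ 2 ≤ 2 * (1 + d ^ 2) := by nlinarith [sq_nonneg (1 - d)]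
  refine (mul_le_mul h5 h6 (sq_nonneg _) (by positivity)).trans (le_of_eq (by ring))

theorem norm_noise_sq_le {σ c ρ : ℝ} (hf : ∀ j i z, |S.f j i z| ≤ σ * ‖z‖ + c) {k : ℕ} {ω : Ω}
    (hA : ∀ i j, |S.A k ω i j| ≤ ρ) (ha : 0 ≤ S.a k) (hb : 0 ≤ S.b k) (hl : 0 ≤ S.lam k) :
    ‖S.a k • S.measNoise k ω + S.b k • S.commNoise k ω‖ ^ 2
      ≤ S.gainSum k ^ 2 * (2 * (S.frobSq k ω + N * ρ ^ 2 * (8 * σ ^ 2 + 2 * c ^ 2))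
        * S.noiseSq k ω * (1 + ‖S.δ k ω‖ ^ 2)) := by
  have ht := S.frobSq_nonneg k ω
  have hw := S.noiseSq_nonneg k ω
  have hae : S.a k ≤ S.gainSum k := by rw [gainSum]; linarith
  have hbe : S.b k ≤ S.gainSum k := by rw [gainSum]; linarith
  have h1 := norm_add_sq_le_two_mul (S.a k • S.measNoise k ω) (S.b k • S.commNoise k ω)
  rw [norm_smul, norm_smul, mul_pow, mul_pow, Real.norm_of_nonneg ha, Real.norm_of_nonneg hb] at h1
  have hv : ‖S.vStack k ω‖ ^ 2 ≤ S.noiseSq k ω := by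
    rw [noiseSq]; linarith [sq_nonneg ‖S.ξStack k ω‖]
  have hξ : ‖S.ξStack k ω‖ ^ 2 ≤ S.noiseSq k ω := by
    rw [noiseSq]; linarith [sq_nonneg ‖S.vStack k ω‖]
  have h2 := (S.norm_measNoise_sq_le k ω).trans (mul_le_mul_of_nonneg_left hv ht)
  have h3 := S.norm_commNoise_sq_le hf hA
  have hMf0 : 0 ≤ N * ρ ^ 2 * (8 * σ ^ 2 + 2 * c ^ 2) := by positivity
  generalize N * ρ ^ 2 * (8 * σ ^ 2 + 2 * c ^ 2) = Mf at *
  have hd := sq_nonneg ‖S.δ k ω‖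
  generalize ‖S.δ k ω‖ ^ 2 = d at *
  have h3' := h3.trans (mul_le_mul_of_nonneg_left
    (mul_le_mul_of_nonneg_left hξ (by linarith : 0 ≤ 1 + d)) hMf0)
  generalize S.frobSq k ω = t at *
  generalize S.noiseSq k ω = w at *
  have h2' : ‖S.measNoise k ω‖ ^ 2 ≤ t * w * (1 + d) := by
    have : 0 ≤ t * w * d := by positivity
    linarith
  have h4 := mul_le_mul (pow_le_pow_left₀ ha hae 2) h2' (sq_nonneg _) (sq_nonneg (S.gainSum k))
  have h5 := mul_le_mul (pow_le_pow_left₀ hb hbe 2) h3' (sq_nonneg _) (sq_nonneg (S.gainSum k))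
  refine h1.trans ?_
  linarith

theorem exists_step_bounds {σ c ρ : ℝ} (hf : ∀ j i z, |S.f j i z| ≤ σ * ‖z‖ + c) (hρ : 0 ≤ ρ)
    (ha : ∀ k, 0 ≤ S.a k) (hb : ∀ k, 0 ≤ S.b k) (hl : ∀ k, 0 ≤ S.lam k) :
    ∃ M : ℝ, 1 ≤ M ∧ ∀ k ω, (∀ i j, |S.A k ω i j| ≤ ρ) → (∀ i j, |S.lap k ω i j| ≤ ρ) →
      N * n * ρ + S.frobSq k ω ≤ S.stepFactor M k ω ∧
      ‖S.δ (k + 1) ω - S.δ k ω‖ ^ 2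
        ≤ S.gainSum k ^ 2 * (S.stepFactor M k ω * (1 + ‖S.δ k ω‖ ^ 2)) ∧
      ‖S.δ (k + 1) ω‖ ^ 2 ≤ ‖S.δ k ω‖ ^ 2
        - 2 * inner ℝ (S.δ k ω) (toEuclideanLin (S.gainMat k (S.lap k ω) ω) (S.δ k ω))
        + 2 * S.noiseInner k ω
        + (S.gainSum k ^ 2 + S.lam k) * (S.stepFactor M k ω * (1 + ‖S.δ k ω‖ ^ 2)) := by
  have hκ0 : 0 ≤ ‖S.x₀Stack‖ := norm_nonneg _
  have hNn : 0 ≤ N * n * ρ := by positivity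
  have hMf0 : 0 ≤ N * ρ ^ 2 * (8 * σ ^ 2 + 2 * c ^ 2) := by positivity
  obtain ⟨Mf, hMf⟩ : ∃ Mf, N * ρ ^ 2 * (8 * σ ^ 2 + 2 * c ^ 2) = Mf := ⟨_, rfl⟩
  obtain ⟨ℓ, hℓ⟩ : ∃ ℓ, N * n * ρ + 1 + ‖S.x₀Stack‖ = ℓ := ⟨_, rfl⟩
  -- Large enough to dominate every coefficient below: 8ℓ² from the drift, 4Mf from the
  -- communication noise, and numerical constants.
  obtain ⟨M, hM⟩ : ∃ M, 8 * ℓ ^ 2 + 4 * Mf + 12 = M := ⟨_, rfl⟩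
  rw [hMf] at hMf0
  have hℓ0 : 1 ≤ ℓ := by linarith
  have hM12 : 12 ≤ M := by nlinarith
  have hMℓ : ℓ ≤ M := by nlinarith
  have hMf4 : 4 * Mf + 4 ≤ M := by nlinarith
  have hM8 : 8 * ℓ ^ 2 ≤ M := by linarith
  refine ⟨M, by linarith, fun k ω hA hL => ?_⟩
  have ht := S.frobSq_nonneg k ω
  have hw := S.noiseSq_nonneg k ω
  have hgsq := S.norm_gainMat_add_sq_le hρ hL (ha k) (hb k) (hl k)
  have hνsq := S.norm_noise_sq_le hf hA (ha k) (hb k) (hl k)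
  rw [hMf] at hνsq
  rw [hℓ] at hgsq
  have hX : 0 ≤ 1 + ‖S.δ k ω‖ ^ 2 := by positivity
  have hR : S.stepFactor M k ω =
    M * (1 + S.frobSq k ω ^ 2 + (1 + S.frobSq k ω) * S.noiseSq k ω) := rfl
  have hRM : M * (1 + S.frobSq k ω ^ 2) ≤ S.stepFactor M k ω := by
    rw [hR]
    have : 0 ≤ M * ((1 + S.frobSq k ω) * S.noiseSq k ω) := by positivity
    linarith
  have hstepsq : ‖S.δ (k + 1) ω - S.δ k ω‖ ^ 2
      ≤ S.gainSum k ^ 2 * (S.stepFactor M k ω * (1 + ‖S.δ k ω‖ ^ 2)) := by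
    rw [S.δ_succ k ω]
    refine (norm_add_sq_le_two_mul _ _).trans ?_
    rw [norm_neg]
    have h2 : 2 * (4 * ℓ ^ 2 + 4 * S.frobSq k ω ^ 2)
        + 2 * (2 * (S.frobSq k ω + Mf) * S.noiseSq k ω) ≤ S.stepFactor M k ω := by
      rw [hR]
      have q2 := mul_le_mul_of_nonneg_right (by linarith : 8 ≤ M) (sq_nonneg (S.frobSq k ω))
      have q3 := mul_le_mul_of_nonneg_right (by linarith : 4 * Mf ≤ M) hw
      have q4 := mul_le_mul_of_nonneg_right (by linarith : 4 ≤ M) (mul_nonneg ht hw)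
      linarith
    have h3 := mul_le_mul_of_nonneg_left (mul_le_mul_of_nonneg_right h2 hX)
      (sq_nonneg (S.gainSum k))
    linarith
  refine ⟨?_, hstepsq, ?_⟩
  · refine le_trans ?_ hRM
    have h0 : N * n * ρ + 1 ≤ M := by linarith
    have h1 := mul_le_mul_of_nonneg_right (by linarith : 1 ≤ M) (sq_nonneg (S.frobSq k ω))
    nlinarith [sq_nonneg (S.frobSq k ω - 1)]
  · have h2 : ‖S.δ (k + 1) ω‖ ^ 2 = ‖S.δ k ω‖ ^ 2
        + 2 * inner ℝ (S.δ k ω) (S.δ (k + 1) ω - S.δ k ω)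
        + ‖S.δ (k + 1) ω - S.δ k ω‖ ^ 2 := by
      rw [← norm_add_sq_real, add_sub_cancel]
    have h3 : inner ℝ (S.δ k ω) (S.δ (k + 1) ω - S.δ k ω) =
        -inner ℝ (S.δ k ω) (toEuclideanLin (S.gainMat k (S.lap k ω) ω) (S.δ k ω))
        - S.lam k * (‖S.δ k ω‖ ^ 2 + inner ℝ (S.δ k ω) S.x₀Stack) + S.noiseInner k ω := by
      rw [S.δ_succ k ω, noiseInner]
      simp only [inner_add_right, inner_neg_right, real_inner_smul_right,
        real_inner_self_eq_norm_sq]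
      ring
    -- The contracting part −2‖δ‖² of the regularization is discarded; the bias towards the origin
    -- is charged to the error with weight λ(k).
    have h4 : -(2 * (‖S.δ k ω‖ ^ 2 + inner ℝ (S.δ k ω) S.x₀Stack))
        ≤ S.stepFactor M k ω * (1 + ‖S.δ k ω‖ ^ 2) := by
      have h5 := (abs_le.1 (abs_real_inner_le_norm (S.δ k ω) S.x₀Stack)).1
      have hRM' : ‖S.x₀Stack‖ ≤ S.stepFactor M k ω := by
        have : 0 ≤ M * S.frobSq k ω ^ 2 := by positivity
        linarith
      have h6 := mul_le_mul_of_nonneg_right hRM' hX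
      have h8 : 2 * (‖S.δ k ω‖ * ‖S.x₀Stack‖) ≤ ‖S.x₀Stack‖ * (1 + ‖S.δ k ω‖ ^ 2) := by
        have := mul_nonneg hκ0 (sq_nonneg (1 - ‖S.δ k ω‖))
        linarith
      linarith [sq_nonneg ‖S.δ k ω‖]
    have h9 := mul_le_mul_of_nonneg_left h4 (hl k)
    rw [h2, h3]
    linarith

end Bounds

end RegressionNetwork

/-! ### Measurability with respect to the filtration. -/

namespace RegressionNetwork

open Matrix

theorem measurable_euclideanSpace_of_apply {Ω ι : Type*} [Fintype ι] {m : MeasurableSpace Ω}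
    {f : Ω → EuclideanSpace ℝ ι} (hf : ∀ i, Measurable fun ω => f ω i) : Measurable f :=
  (WithLp.measurable_toLp 2 _).comp (measurable_pi_lambda (fun ω i => f ω i) hf)

section Measurability

variable {Ω : Type*} [mΩ : MeasurableSpace Ω] {N n : ℕ} (S : RegressionNetwork Ω N n)

theorem measurable_A_sigmaGH (k : ℕ) (i j : Fin N) :
    Measurable[S.sigmaGH k] fun ω => S.A k ω i j := by
  rw [measurable_iff_comap_le, BorelSpace.measurable_eq (α := ℝ)]
  exact le_sup_of_le_left (le_iSup_of_le i (le_iSup_of_le j le_rfl))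

theorem measurable_H_sigmaGH (k : ℕ) (i : Fin N) (r : Fin (S.dim i)) (c : Fin n) :
    Measurable[S.sigmaGH k] fun ω => S.H i k ω r c := by
  rw [measurable_iff_comap_le, BorelSpace.measurable_eq (α := ℝ)]
  exact le_sup_of_le_right (le_iSup_of_le i (le_iSup_of_le r (le_iSup_of_le c le_rfl)))

theorem measurable_vStack_sigmaNoise (k : ℕ) : Measurable[S.sigmaNoise k] (S.vStack k) := by
  rw [measurable_iff_comap_le,
    BorelSpace.measurable_eq (α := EuclideanSpace ℝ (Σ i, Fin (S.dim i)))]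
  exact le_sup_left

theorem measurable_ξStack_sigmaNoise (k : ℕ) : Measurable[S.sigmaNoise k] (S.ξStack k) := by
  rw [measurable_iff_comap_le,
    BorelSpace.measurable_eq (α := EuclideanSpace ℝ (Fin N × Fin N × Fin n))]
  exact le_sup_right

theorem sigmaGH_le (k : ℕ) : S.sigmaGH k ≤ mΩ := by
  refine sup_le (iSup_le fun i => iSup_le fun j => ?_)
    (iSup_le fun i => iSup_le fun r => iSup_le fun c => ?_)
  · rw [← BorelSpace.measurable_eq (α := ℝ)]; exact (S.measurable_A k i j).comap_le
  · rw [← BorelSpace.measurable_eq (α := ℝ)]; exact (S.measurable_H i k r c).comap_le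

theorem measurable_vStack (k : ℕ) : Measurable (S.vStack k) := by
  refine (WithLp.measurable_toLp 2 _).comp (measurable_pi_lambda _ fun p => ?_)
  exact (measurable_pi_apply p.2).comp ((WithLp.measurable_ofLp 2 _).comp (S.measurable_v p.1 k))

theorem measurable_ξStack (k : ℕ) : Measurable (S.ξStack k) := by
  refine (WithLp.measurable_toLp 2 _).comp (measurable_pi_lambda _ fun p => ?_)
  exact (measurable_pi_apply p.2.2).comp
    ((WithLp.measurable_ofLp 2 _).comp (S.measurable_ξ p.2.1 p.1 k))

theorem sigmaNoise_le (k : ℕ) : S.sigmaNoise k ≤ mΩ := by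
  refine sup_le ?_ ?_
  · rw [← BorelSpace.measurable_eq (α := EuclideanSpace ℝ _)]; exact (S.measurable_vStack k).comap_le
  · rw [← BorelSpace.measurable_eq (α := EuclideanSpace ℝ _)]; exact (S.measurable_ξStack k).comap_le

theorem past_le (k : ℕ) : S.past k ≤ mΩ :=
  iSup_le fun s => iSup_le fun _ => sup_le (S.sigmaGH_le s) (S.sigmaNoise_le s)

theorem past_mono : Monotone S.past := fun _ _ h =>
  iSup_mono fun _ => iSup_mono' fun hs => ⟨lt_of_lt_of_le hs h, le_rfl⟩

theorem sigmaGH_le_past_succ (k : ℕ) : S.sigmaGH k ≤ S.past (k + 1) :=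
  le_iSup_of_le k (le_iSup_of_le k.lt_succ_self le_sup_left)

theorem sigmaNoise_le_past_succ (k : ℕ) : S.sigmaNoise k ≤ S.past (k + 1) :=
  le_iSup_of_le k (le_iSup_of_le k.lt_succ_self le_sup_right)

/-- Separates the past into the two independent families, the form in which conditional expectations
of products factor. -/
theorem past_eq_sup (k : ℕ) :
    S.past k = (⨆ s, ⨆ _ : s < k, S.sigmaGH s) ⊔ (⨆ s, ⨆ _ : s < k, S.sigmaNoise s) := by
  simp only [past, iSup_sup_eq]

theorem measurable_vStack_apply (k : ℕ) (r : Σ i, Fin (S.dim i)) :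
    Measurable[S.sigmaNoise k] fun ω => S.vStack k ω r :=
  (measurable_pi_apply r).comp
    ((WithLp.measurable_ofLp 2 _).comp (S.measurable_vStack_sigmaNoise k))

theorem measurable_ξStack_apply (k : ℕ) (q : Fin N × Fin N × Fin n) :
    Measurable[S.sigmaNoise k] fun ω => S.ξStack k ω q :=
  (measurable_pi_apply q).comp
    ((WithLp.measurable_ofLp 2 _).comp (S.measurable_ξStack_sigmaNoise k))

theorem measurable_HBlock (k : ℕ) (r : Σ i, Fin (S.dim i)) (c : Fin N × Fin n) :
    Measurable[S.sigmaGH k] fun ω => S.HBlock k ω r c := by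
  by_cases h : r.1 = c.1
  · simpa [HBlock, h] using S.measurable_H_sigmaGH k r.1 r.2 c.2
  · simp [HBlock, h]

theorem measurable_frobSq (k : ℕ) : Measurable[S.sigmaGH k] (S.frobSq k) :=
  Finset.measurable_fun_sum _ fun r _ => Finset.measurable_fun_sum _ fun c _ =>
    (S.measurable_HBlock k r c).pow_const 2

theorem measurable_noiseSq (k : ℕ) : Measurable[S.sigmaNoise k] (S.noiseSq k) :=
  ((measurable_norm.comp (S.measurable_vStack_sigmaNoise k)).pow_const 2).add
    ((measurable_norm.comp (S.measurable_ξStack_sigmaNoise k)).pow_const 2)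

theorem measurable_gram (k : ℕ) (p q : Fin N × Fin n) : Measurable fun ω => S.gram k ω p q := by
  simp only [gram, Matrix.mul_apply, Matrix.transpose_apply]
  exact Finset.measurable_fun_sum _ fun r _ =>
    ((S.measurable_HBlock k r p).mono (S.sigmaGH_le k) le_rfl).mul
      ((S.measurable_HBlock k r q).mono (S.sigmaGH_le k) le_rfl)

theorem measurable_lap (k : ℕ) (i j : Fin N) : Measurable fun ω => S.lap k ω i j := by
  simp only [lap, Matrix.sub_apply, Matrix.diagonal_apply]
  refine Measurable.sub ?_ (S.measurable_A k i j)
  split_ifs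
  · exact Finset.measurable_fun_sum _ fun l _ => S.measurable_A k i l
  · exact measurable_const

theorem measurable_x_past (k : ℕ) (i : Fin N) : Measurable[S.past k] fun ω => S.x k ω i := by
  induction k generalizing i with
  | zero => simpa only [x] using measurable_const
  | succ k ih =>
    have hx : ∀ i, Measurable[S.past (k + 1)] fun ω => S.x k ω i := fun i =>
      (ih i).mono (S.past_mono k.le_succ) le_rfl
    have hxc : ∀ i c, Measurable[S.past (k + 1)] fun ω => S.x k ω i c := fun i c =>
      (measurable_pi_apply c).comp ((WithLp.measurable_ofLp 2 _).comp (hx i))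
    have hH : ∀ i r c, Measurable[S.past (k + 1)] fun ω => S.H i k ω r c := fun i r c =>
      (S.measurable_H_sigmaGH k i r c).mono (S.sigmaGH_le_past_succ k) le_rfl
    have hA : ∀ i j, Measurable[S.past (k + 1)] fun ω => S.A k ω i j := fun i j =>
      (S.measurable_A_sigmaGH k i j).mono (S.sigmaGH_le_past_succ k) le_rfl
    have hv : ∀ i r, Measurable[S.past (k + 1)] fun ω => S.v i k ω r := fun i r =>
      (S.measurable_vStack_apply k ⟨i, r⟩).mono (S.sigmaNoise_le_past_succ k) le_rfl
    have hξ : ∀ j i c, Measurable[S.past (k + 1)] fun ω => S.ξ j i k ω c := fun j i c =>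
      (S.measurable_ξStack_apply k (i, j, c)).mono (S.sigmaNoise_le_past_succ k) le_rfl
    have hf : ∀ j i, Measurable[S.past (k + 1)] fun ω => S.f j i (S.x k ω j - S.x k ω i) :=
      fun j i => (S.measurable_f j i).comp ((hx j).sub (hx i))
    refine measurable_euclideanSpace_of_apply fun c => ?_
    simp only [x_succ_apply]
    refine Measurable.sub (Measurable.add (Measurable.add (hxc i c) ?_) ?_) ((hxc i c).const_mul _)
    · refine Measurable.const_mul (Finset.measurable_fun_sum _ fun r _ => (hH i r c).mul ?_) _
      refine Measurable.sub (Measurable.add ?_ (hv i r)) ?_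
      · exact Finset.measurable_fun_sum _ fun c' _ => (hH i r c').mul_const _
      · exact Finset.measurable_fun_sum _ fun c' _ => (hH i r c').mul (hxc i c')
    · refine Measurable.const_mul (Finset.measurable_fun_sum _ fun j _ => (hA i j).mul ?_) _
      exact ((hxc j c).add ((hf j i).mul (hξ j i c))).sub (hxc i c)

theorem measurable_f_past (k : ℕ) (i j : Fin N) :
    Measurable[S.past k] fun ω => S.f j i (S.x k ω j - S.x k ω i) :=
  (S.measurable_f j i).comp ((S.measurable_x_past k j).sub (S.measurable_x_past k i))

theorem measurable_δ_past (k : ℕ) : Measurable[S.past k] (S.δ k) := by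
  refine measurable_euclideanSpace_of_apply fun p => ?_
  exact Measurable.sub_const ((measurable_pi_apply p.2).comp
    ((WithLp.measurable_ofLp 2 _).comp (S.measurable_x_past k p.1))) _

theorem measurable_δ_apply_past (k : ℕ) (p : Fin N × Fin n) :
    Measurable[S.past k] fun ω => S.δ k ω p :=
  (measurable_pi_apply p).comp ((WithLp.measurable_ofLp 2 _).comp (S.measurable_δ_past k))

end Measurability

/-! ### Conditional moments of regressors and noises. -/

section CondExp

variable {Ω : Type*} [mΩ : MeasurableSpace Ω] {P : Measure Ω} {N n : ℕ}
  {S : RegressionNetwork Ω N n}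

theorem condExp_apply_eq_zero {ι : Type*} [Fintype ι] {F : MeasurableSpace Ω}
    {u : Ω → EuclideanSpace ℝ ι} (hu : Integrable u P) (h0 : P[u | F] =ᵐ[P] 0) (r : ι) :
    Integrable (fun ω => u ω r) P ∧ P[fun ω => u ω r | F] =ᵐ[P] 0 := by
  have h1 := (EuclideanSpace.proj (𝕜 := ℝ) r).comp_condExp_comm (m := F) hu
  refine ⟨(EuclideanSpace.proj (𝕜 := ℝ) r).integrable_comp hu, ?_⟩
  filter_upwards [h1, h0] with ω h1 h0
  refine h1.symm.trans ?_
  simp [h0]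

theorem A2.condLE_noiseSq (h : S.A2 P) : ∃ β : ℝ, 0 ≤ β ∧ ∀ k,
    CondLE P (S.past k) (S.noiseSq k) fun _ => β := by
  obtain ⟨β, hβ⟩ := h.bound
  refine ⟨|β|, abs_nonneg β, fun k => ⟨h.integrable_sq k, ?_⟩⟩
  filter_upwards [hβ] with ω hω
  exact (hω k).trans (le_abs_self β)

/-- The squared Frobenius norm is the trace of the Gram matrix, a sum of Nn diagonal entries each
bounded by the spectral norm. -/
theorem frobSq_le_specNorm (k : ℕ) (ω : Ω) :
    S.frobSq k ω ≤ N * n * specNorm (S.gram k ω) := by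
  have h1 : S.frobSq k ω = ∑ c, S.gram k ω c c := by
    rw [frobSq, Finset.sum_comm]
    simp [gram, Matrix.mul_apply, sq]
  rw [h1]
  refine (Finset.sum_le_sum fun c _ => (le_abs_self _).trans
    (abs_apply_le_specNorm (S.gram k ω) c c)).trans (le_of_eq ?_)
  simp

variable {h : ℕ} {ρ₀ : ℝ}

theorem UniformBound.specNorm_lap_le (hb : S.UniformBound P h ρ₀) :
    ∀ᵐ ω ∂P, ∀ k, specNorm (S.lap k ω) ≤ ρ₀ := by
  have h0 : ∀ᵐ ω ∂P, ∀ k, 0 ≤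
      (P[fun ω' => specNorm (S.gram k ω') ^ (2 ^ max h 2) | S.past k]) ω := by
    rw [ae_all_iff]
    exact fun k => condExp_nonneg (ae_of_all _ fun ω => pow_nonneg (norm_nonneg _) _)
  filter_upwards [hb.bound, h0] with ω hω h0 k
  linarith [hω k, Real.rpow_nonneg (h0 k) (1 / (2 ^ max h 2 : ℝ))]

variable [IsProbabilityMeasure P]

/-- Conditionally on the past, the noises at time `k` are independent of the graph and the
regression matrices at time `k`. -/
theorem A2.condExp_mul (h : S.A2 P) {k : ℕ} {g η : Ω → ℝ} (hg : Measurable[S.sigmaGH k] g)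
    (hη : Measurable[S.sigmaNoise k] η) (hgi : Integrable g P) (hηi : Integrable η P) :
    Integrable (fun ω => g ω * η ω) P ∧
      P[fun ω => g ω * η ω | S.past k] =ᵐ[P]
        fun ω => (P[g | S.past k]) ω * (P[η | S.past k]) ω := by
  have key : ∀ {g η : Ω → ℝ}, Measurable[S.sigmaGH k] g → Measurable[S.sigmaNoise k] η →
      Integrable g P → Integrable η P → Integrable (fun ω => g ω * η ω) P ∧
      P[fun ω => g ω * η ω | S.past k] =ᵐ[P]
        fun ω => (P[g | ⨆ s, ⨆ _ : s < k, S.sigmaGH s]) ω *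
          (P[η | ⨆ s, ⨆ _ : s < k, S.sigmaNoise s]) ω := by
    intro g η hg hη hgi hηi
    rw [S.past_eq_sup k]
    exact condExp_mul_of_indep (iSup_le S.sigmaGH_le) (iSup_le S.sigmaNoise_le)
      (iSup_mono fun s => iSup_le fun _ => le_rfl) (iSup_mono fun s => iSup_le fun _ => le_rfl)
      h.indep.symm
      (hg.stronglyMeasurable.mono (le_iSup S.sigmaGH k))
      (hη.stronglyMeasurable.mono (le_iSup S.sigmaNoise k)) hgi hηi
  have h1 : ∀ {F : MeasurableSpace Ω}, F ≤ mΩ → P[fun _ => (1 : ℝ) | F] = fun _ => 1 :=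
    fun hF => condExp_const hF _
  have hGle : (⨆ s, ⨆ _ : s < k, S.sigmaGH s) ≤ mΩ :=
    iSup_le fun s => iSup_le fun _ => S.sigmaGH_le s
  have hNle : (⨆ s, ⨆ _ : s < k, S.sigmaNoise s) ≤ mΩ :=
    iSup_le fun s => iSup_le fun _ => S.sigmaNoise_le s
  obtain ⟨hi, he⟩ := key hg hη hgi hηi
  -- Taking one factor equal to 1 shows that conditioning on the whole past agrees with conditioning
  -- on the past of the factor's own family.
  have hg1 := (key hg measurable_const hgi (integrable_const (1 : ℝ))).2
  have hη1 := (key measurable_const hη (integrable_const (1 : ℝ)) hηi).2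
  simp only [h1 hGle, h1 hNle, mul_one, one_mul] at hg1 hη1
  refine ⟨hi, ?_⟩
  filter_upwards [he, hg1, hη1] with ω he hg1 hη1
  rw [he, hg1, hη1]

theorem A2.condExp_mul_eq_zero (h : S.A2 P) {k : ℕ} {g η : Ω → ℝ}
    (hg : Measurable[S.sigmaGH k] g) (hη : Measurable[S.sigmaNoise k] η) (hgi : Integrable g P)
    (hηi : Integrable η P) (hη0 : P[η | S.past k] =ᵐ[P] 0) :
    Integrable (fun ω => g ω * η ω) P ∧ P[fun ω => g ω * η ω | S.past k] =ᵐ[P] 0 := by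
  obtain ⟨hi, he⟩ := h.condExp_mul hg hη hgi hηi
  refine ⟨hi, ?_⟩
  filter_upwards [he, hη0] with ω he h0
  rw [he, h0]
  simp

/-- The exponent p is at least 2, so s² ≤ 1 + sᵖ for s ≥ 0, and the p-th conditional moment is at
most |ρ₀|ᵖ. -/
theorem UniformBound.condLE_frobSq_sq (hb : S.UniformBound P h ρ₀) : ∃ C : ℝ, 0 ≤ C ∧ ∀ k,
    CondLE P (S.past k) (fun ω => S.frobSq k ω ^ 2) fun _ => C := by
  refine ⟨(N * n) ^ 2 * (1 + |ρ₀| ^ (2 ^ max h 2)), by positivity, fun k => ?_⟩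
  have hp : 2 ≤ 2 ^ max h 2 := by
    calc 2 = 2 ^ 1 := by norm_num
      _ ≤ 2 ^ max h 2 := Nat.pow_le_pow_right (by norm_num) (by omega)
  have h1 : CondLE P (S.past k) (fun ω => specNorm (S.gram k ω) ^ (2 ^ max h 2))
      fun _ => |ρ₀| ^ (2 ^ max h 2) := by
    refine ⟨hb.integrable_gram k, ?_⟩
    filter_upwards [hb.bound, condExp_nonneg (m := S.past k) (μ := P)
      (f := fun ω => specNorm (S.gram k ω) ^ (2 ^ max h 2))
      (ae_of_all _ fun ω => pow_nonneg (norm_nonneg _) _)] with ω hω h0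
    have h2 := hω k
    have h3 : 0 ≤ specNorm (S.lap k ω) := norm_nonneg _
    set Y := (P[fun ω' => specNorm (S.gram k ω') ^ (2 ^ max h 2) | S.past k]) ω
    have h0' : 0 ≤ Y := h0
    have h4 : Y ^ (1 / (2 ^ max h 2 : ℝ)) ≤ |ρ₀| := by linarith [le_abs_self ρ₀]
    have h5 := pow_le_pow_left₀ (Real.rpow_nonneg h0' _) h4 (2 ^ max h 2)
    rwa [← Real.rpow_natCast, ← Real.rpow_mul h0', Nat.cast_pow, Nat.cast_ofNat,
      one_div_mul_cancel (by positivity), Real.rpow_one] at h5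
  have h2 := ((CondLE.self (P := P) (S.past_le k) (stronglyMeasurable_const (b := (1 : ℝ)))
    (integrable_const _)).add h1).const_mul (c := ((N : ℝ) * n) ^ 2) (by positivity)
  refine h2.mono_left_of_nonneg (((S.measurable_frobSq k).mono (S.sigmaGH_le k)
    le_rfl).pow_const 2).aestronglyMeasurable (fun ω => sq_nonneg _) (ae_of_all _ fun ω => ?_)
  refine (pow_le_pow_left₀ (S.frobSq_nonneg k ω) (frobSq_le_specNorm k ω) 2).trans ?_
  rw [mul_pow]
  refine mul_le_mul_of_nonneg_left ?_ (sq_nonneg _)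
  have hs : 0 ≤ specNorm (S.gram k ω) := norm_nonneg _
  rcases le_total (specNorm (S.gram k ω)) 1 with h3 | h3
  · linarith [pow_le_one₀ (n := 2) hs h3, pow_nonneg hs (2 ^ max h 2)]
  · linarith [pow_le_pow_right₀ h3 hp]

end CondExp

end RegressionNetwork

/-! ### Zero-mean noise terms and the conditional mean of the quadratic form. -/

theorem CondLE.sum_zero {Ω ι : Type*} {mΩ : MeasurableSpace Ω} {P : Measure Ω}
    [IsProbabilityMeasure P] {F : MeasurableSpace Ω} (hF : F ≤ mΩ) (s : Finset ι)
    {Y : ι → Ω → ℝ} (h : ∀ i ∈ s, CondLE P F (Y i) fun _ => 0) :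
    CondLE P F (fun ω => ∑ i ∈ s, Y i ω) fun _ => 0 := by
  classical
  induction s using Finset.induction_on with
  | empty => simpa using CondLE.self (P := P) hF stronglyMeasurable_const (integrable_const (0 : ℝ))
  | insert i s hi ih =>
    simp only [Finset.sum_insert hi]
    simpa using (h i (by simp)).add (ih fun j hj => h j (by simp [hj]))

/-- The factor `Z` may be unbounded, so integrability of the product comes from the dominating
function `Y`. -/
theorem condLE_zero_mul {Ω : Type*} {mΩ : MeasurableSpace Ω} {P : Measure Ω}
    [IsProbabilityMeasure P] {F : MeasurableSpace Ω} (hF : F ≤ mΩ) {Z W Y : Ω → ℝ}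
    (hZ : Measurable[F] Z) (hW : Integrable W P) (hW0 : P[W | F] =ᵐ[P] 0) (hY : Integrable Y P)
    (hle : ∀ᵐ ω ∂P, |Z ω * W ω| ≤ Y ω) : CondLE P F (fun ω => Z ω * W ω) fun _ => 0 := by
  have hi : Integrable (fun ω => Z ω * W ω) P :=
    hY.mono' ((hZ.mono hF le_rfl).aestronglyMeasurable.mul hW.1) hle
  refine ⟨hi, ?_⟩
  filter_upwards [condExp_mul_of_stronglyMeasurable_left (μ := P) hZ.stronglyMeasurable hi hW, hW0]
    with ω h1 h2
  refine h1.le.trans ?_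
  simp [h2]

namespace RegressionNetwork

open Matrix

section StepMoments

variable {Ω : Type*} [mΩ : MeasurableSpace Ω] {P : Measure Ω} {N n : ℕ}
  {S : RegressionNetwork Ω N n} {h : ℕ} {ρ₀ : ℝ}

theorem UniformBound.abs_lap_le (hb : S.UniformBound P h ρ₀) :
    ∀ᵐ ω ∂P, ∀ k i j, |S.lap k ω i j| ≤ ρ₀ := by
  filter_upwards [hb.specNorm_lap_le] with ω hω k i j
  exact (abs_apply_le_specNorm _ i j).trans (hω k)

theorem abs_A_le_of_abs_lap_le (hρ₀ : 0 ≤ ρ₀) {k : ℕ} {ω : Ω} (hL : ∀ i j, |S.lap k ω i j| ≤ ρ₀)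
    (i j : Fin N) : |S.A k ω i j| ≤ ρ₀ := by
  by_cases hij : i = j
  · rw [hij, S.A_diag, abs_zero]; exact hρ₀
  · have := hL i j
    rwa [lap, Matrix.sub_apply, diagonal_apply_ne _ hij, zero_sub, abs_neg] at this

theorem abs_lapSym_le_of_abs_lap_le {k : ℕ} {ω : Ω} (hL : ∀ i j, |S.lap k ω i j| ≤ ρ₀)
    (i j : Fin N) : |S.lapSym k ω i j| ≤ ρ₀ := by
  rw [lapSym, Matrix.smul_apply, Matrix.add_apply, transpose_apply, smul_eq_mul, abs_mul]
  have := abs_add_le (S.lap k ω i j) (S.lap k ω j i)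
  have h1 := hL i j
  have h2 := hL j i
  rw [abs_of_nonneg (by norm_num : (0 : ℝ) ≤ 1 / 2)]
  linarith

theorem abs_δ_apply_le (k : ℕ) (ω : Ω) (p : Fin N × Fin n) : |S.δ k ω p| ≤ ‖S.δ k ω‖ :=
  PiLp.norm_apply_le (S.δ k ω) p

theorem HBlock_apply_sq_le (k : ℕ) (ω : Ω) (r : Σ i, Fin (S.dim i)) (p : Fin N × Fin n) :
    S.HBlock k ω r p ^ 2 ≤ S.frobSq k ω :=
  (Finset.single_le_sum (f := fun c => S.HBlock k ω r c ^ 2) (fun _ _ => sq_nonneg _)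
    (Finset.mem_univ p)).trans (Finset.single_le_sum
    (f := fun r => ∑ c, S.HBlock k ω r c ^ 2)
    (fun _ _ => Finset.sum_nonneg fun _ _ => sq_nonneg _) (Finset.mem_univ r))

/-- Entrywise conditional expectation of the symmetrized gain matrix. -/
noncomputable def condGainMat (S : RegressionNetwork Ω N n) (P : Measure Ω) (m i : ℕ) (ω : Ω) :
    Matrix (Fin N × Fin n) (Fin N × Fin n) ℝ :=
  S.b i • (condMat P (S.past m) (S.lapSym i) ω ⊗ₖ (1 : Matrix (Fin n) (Fin n) ℝ))
    + S.a i • condMat P (S.past m) (S.gram i) ω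

theorem condGainMat_isHermitian (m i : ℕ) (ω : Ω) : (S.condGainMat P m i ω).IsHermitian := by
  have h1 : ∀ r c, condMat P (S.past m) (S.lapSym i) ω r c =
      condMat P (S.past m) (S.lapSym i) ω c r := by
    intro r c
    simp only [condMat, of_apply]
    congr 2
    funext ω'
    simp only [lapSym, Matrix.smul_apply, Matrix.add_apply, transpose_apply]
    rw [add_comm]
  have h2 : ∀ r c, condMat P (S.past m) (S.gram i) ω r c =
      condMat P (S.past m) (S.gram i) ω c r := by
    intro r c
    simp only [condMat, of_apply]
    congr 2
    funext ω'
    simp only [gram, Matrix.mul_apply, transpose_apply, mul_comm]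
  refine Matrix.IsHermitian.ext fun p q => ?_
  simp only [condGainMat, Matrix.add_apply, Matrix.smul_apply, kroneckerMap_apply, star_trivial,
    h1 q.1 p.1, h2 q p, Matrix.one_apply, eq_comm (a := q.2)]

variable [IsProbabilityMeasure P]

theorem UniformBound.integrable_frobSq (hb : S.UniformBound P h ρ₀) (k : ℕ) :
    Integrable (S.frobSq k) P := by
  obtain ⟨C, -, hC⟩ := hb.condLE_frobSq_sq
  refine ((integrable_const (1 : ℝ)).add (hC k).1).mono'
    ((S.measurable_frobSq k).mono (S.sigmaGH_le k) le_rfl).aestronglyMeasurable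
    (ae_of_all _ fun ω => ?_)
  rw [Real.norm_of_nonneg (S.frobSq_nonneg k ω), Pi.add_apply]
  nlinarith [sq_nonneg (S.frobSq k ω - 1)]

theorem A2.condLE_stepFactor (hA2 : S.A2 P) (hb : S.UniformBound P h ρ₀) {M : ℝ} (hM : 0 ≤ M) :
    ∃ C : ℝ, 0 ≤ C ∧ ∀ k, CondLE P (S.past k) (S.stepFactor M k) fun _ => C := by
  obtain ⟨C, hC0, hC⟩ := hb.condLE_frobSq_sq
  obtain ⟨β, hβ0, hβ⟩ := hA2.condLE_noiseSq
  refine ⟨M * (1 + C + β + (1 + C) * β), by positivity, fun k => ?_⟩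
  have h1 : CondLE P (S.past k) (fun _ => (1 : ℝ)) fun _ => 1 :=
    CondLE.self (S.past_le k) stronglyMeasurable_const (integrable_const _)
  have hf : CondLE P (S.past k) (S.frobSq k) fun _ => 1 + C := by
    refine (h1.add (hC k)).mono_left (hb.integrable_frobSq k) (ae_of_all _ fun ω => ?_)
    nlinarith [sq_nonneg (S.frobSq k ω - 1)]
  -- The mixed term is the only one that needs conditional independence of regressors and noises.
  obtain ⟨hi, he⟩ := hA2.condExp_mul (S.measurable_frobSq k) (S.measurable_noiseSq k)
    (hb.integrable_frobSq k) (hβ k).1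
  have hfn : CondLE P (S.past k) (fun ω => S.frobSq k ω * S.noiseSq k ω)
      fun _ => (1 + C) * β := by
    refine ⟨hi, ?_⟩
    filter_upwards [he, hf.2, (hβ k).2, condExp_nonneg (m := S.past k) (μ := P)
      (ae_of_all _ (S.noiseSq_nonneg k))] with ω h1 h2 h3 h4
    rw [h1]
    exact mul_le_mul h2 h3 h4 (by positivity)
  have hs := (((h1.add (hC k)).add (hβ k)).add hfn).const_mul hM
  have heq : S.stepFactor M k = fun ω => M * (1 + S.frobSq k ω ^ 2 + S.noiseSq k ω +
      S.frobSq k ω * S.noiseSq k ω) := by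
    funext ω
    rw [stepFactor]
    ring
  rwa [heq]

theorem A2.condLE_inner_measNoise (hA2 : S.A2 P) (hb : S.UniformBound P h ρ₀) {k : ℕ}
    (hX : Integrable (fun ω => 1 + ‖S.δ k ω‖ ^ 2) P) :
    CondLE P (S.past k) (fun ω => inner ℝ (S.δ k ω) (S.measNoise k ω)) fun _ => 0 := by
  have hHi : ∀ r p, Integrable (fun ω => S.HBlock k ω r p) P := fun r p => by
    refine ((integrable_const (1 : ℝ)).add (hb.integrable_frobSq k)).mono'
      ((S.measurable_HBlock k r p).mono (S.sigmaGH_le k) le_rfl).aestronglyMeasurable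
      (ae_of_all _ fun ω => ?_)
    have h1 := HBlock_apply_sq_le (S := S) k ω r p
    rw [Real.norm_eq_abs, Pi.add_apply]
    rw [← sq_abs] at h1
    nlinarith [sq_nonneg (|S.HBlock k ω r p| - 1)]
  have hfn := (hA2.condExp_mul (S.measurable_frobSq k) (S.measurable_noiseSq k)
    (hb.integrable_frobSq k) (hA2.integrable_sq k)).1
  have hexp : (fun ω => inner ℝ (S.δ k ω) (S.measNoise k ω)) = fun ω =>
      ∑ p, ∑ r, S.δ k ω p * (S.HBlock k ω r p * S.vStack k ω r) := by
    funext ω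
    simp only [PiLp.inner_apply, measNoise, mulVec, dotProduct, transpose_apply,
      ← Finset.mul_sum]
    exact Finset.sum_congr rfl fun p _ => by simp [mul_comm]
  rw [hexp]
  refine CondLE.sum_zero (S.past_le k) _ fun p _ => CondLE.sum_zero (S.past_le k) _ fun r _ => ?_
  obtain ⟨hvi, hv0⟩ := condExp_apply_eq_zero (hA2.integrable_v k) (hA2.condExp_v k) r
  obtain ⟨hWi, hW0⟩ := hA2.condExp_mul_eq_zero (S.measurable_HBlock k r p)
    (S.measurable_vStack_apply k r) (hHi r p) hvi hv0
  -- The coordinate of δ is known, the product of regressor and noise has zero conditional mean, and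
  -- AM–GM supplies the dominating function.
  refine condLE_zero_mul (S.past_le k) (S.measurable_δ_apply_past k p) hWi hW0 (hX.add hfn)
    (ae_of_all _ fun ω => ?_)
  have h1 := HBlock_apply_sq_le (S := S) k ω r p
  have h2 : S.vStack k ω r ^ 2 ≤ S.noiseSq k ω := by
    have := pow_le_pow_left₀ (norm_nonneg _) (PiLp.norm_apply_le (S.vStack k ω) r) 2
    rw [Real.norm_eq_abs, sq_abs] at this
    rw [noiseSq]
    linarith [sq_nonneg ‖S.ξStack k ω‖]
  have h3 := pow_le_pow_left₀ (abs_nonneg _) (abs_δ_apply_le (S := S) k ω p) 2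
  have h4 := mul_le_mul h1 h2 (sq_nonneg _) (S.frobSq_nonneg k ω)
  rw [abs_mul, Pi.add_apply]
  rw [← mul_pow, ← sq_abs] at h4
  have h5 := two_mul_le_add_sq |S.δ k ω p| |S.HBlock k ω r p * S.vStack k ω r|
  have h6 : 0 ≤ |S.δ k ω p| * |S.HBlock k ω r p * S.vStack k ω r| := by positivity
  linarith

theorem A2.condLE_inner_commNoise (hA2 : S.A2 P) (hA1 : S.A1) (hb : S.UniformBound P h ρ₀)
    (hρ₀ : 0 ≤ ρ₀) {k : ℕ} (hX : Integrable (fun ω => 1 + ‖S.δ k ω‖ ^ 2) P) :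
    CondLE P (S.past k) (fun ω => inner ℝ (S.δ k ω) (S.commNoise k ω)) fun _ => 0 := by
  obtain ⟨σ, c, hf⟩ := hA1
  obtain ⟨β, hβ0, hβ⟩ := hA2.condLE_noiseSq
  have hA : ∀ᵐ ω ∂P, ∀ i j, |S.A k ω i j| ≤ ρ₀ := by
    filter_upwards [hb.abs_lap_le] with ω hω
    exact abs_A_le_of_abs_lap_le hρ₀ (hω k)
  have hXn : Integrable (fun ω => S.noiseSq k ω * (1 + ‖S.δ k ω‖ ^ 2)) P :=
    ((hβ k).mul_left (Z := fun ω => 1 + ‖S.δ k ω‖ ^ 2) (S.past_le k) (S.noiseSq_nonneg k)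
      (stronglyMeasurable_const.add
      ((S.measurable_δ_past k).stronglyMeasurable.norm.pow 2)) (fun ω => by positivity) hX).1
  have hexp : (fun ω => inner ℝ (S.δ k ω) (S.commNoise k ω)) = fun ω =>
      ∑ p, ∑ j, (S.δ k ω p * S.f j p.1 (S.x k ω j - S.x k ω p.1)) *
        (S.A k ω p.1 j * S.ξStack k ω (p.1, j, p.2)) := by
    funext ω
    simp only [PiLp.inner_apply, commNoise, RCLike.inner_apply, conj_trivial, Finset.sum_mul]
    refine Finset.sum_congr rfl fun p _ => Finset.sum_congr rfl fun j _ => ?_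
    simp only [ξStack]
    ring
  rw [hexp]
  refine CondLE.sum_zero (S.past_le k) _ fun p _ => CondLE.sum_zero (S.past_le k) _ fun j _ => ?_
  obtain ⟨hξi, hξ0⟩ := condExp_apply_eq_zero (hA2.integrable_ξ k) (hA2.condExp_ξ k) (p.1, j, p.2)
  have hAi : Integrable (fun ω => S.A k ω p.1 j) P :=
    (integrable_const ρ₀).mono' (S.measurable_A k p.1 j).aestronglyMeasurable
      (by filter_upwards [hA] with ω hω using hω _ _)
  obtain ⟨hWi, hW0⟩ := hA2.condExp_mul_eq_zero (S.measurable_A_sigmaGH k p.1 j)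
    (S.measurable_ξStack_apply k (p.1, j, p.2)) hAi hξi hξ0
  refine condLE_zero_mul (S.past_le k)
    ((S.measurable_δ_apply_past k p).mul (S.measurable_f_past k p.1 j)) hWi hW0
    ((hX.const_mul (ρ₀ ^ 2)).add (hXn.const_mul (8 * σ ^ 2 + 2 * c ^ 2))) ?_
  filter_upwards [hA] with ω hA
  have h1 := pow_le_pow_left₀ (abs_nonneg _) (abs_δ_apply_le (S := S) k ω p) 2
  have h2 := S.f_sq_le hf k ω p.1 j
  have h3 := pow_le_pow_left₀ (abs_nonneg _) (hA p.1 j) 2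
  have h4 : S.ξStack k ω (p.1, j, p.2) ^ 2 ≤ S.noiseSq k ω := by
    have := pow_le_pow_left₀ (norm_nonneg _) (PiLp.norm_apply_le (S.ξStack k ω) (p.1, j, p.2)) 2
    rw [Real.norm_eq_abs, sq_abs] at this
    rw [noiseSq]
    linarith [sq_nonneg ‖S.vStack k ω‖]
  rw [Pi.add_apply]
  -- Regrouped before AM–GM: squaring d·f together would require a fourth moment of δ, while d·A and
  -- f·ξ need only the second.
  have hprod : ∀ d f A ξ : ℝ, |d * f * (A * ξ)| = |d| * |A| * (|f| * |ξ|) := fun d f A ξ => by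
    simp only [abs_mul]; ring
  rw [hprod]
  rw [← sq_abs] at h2 h4
  have h5 := mul_le_mul h3 (h1.trans (by linarith : ‖S.δ k ω‖ ^ 2 ≤ 1 + ‖S.δ k ω‖ ^ 2))
    (sq_nonneg _) (sq_nonneg _)
  have h6 := mul_le_mul h2 h4 (sq_nonneg _) (by positivity)
  have h7 := two_mul_le_add_sq (|S.δ k ω p| * |S.A k ω p.1 j|)
    (|S.f j p.1 (S.x k ω j - S.x k ω p.1)| * |S.ξStack k ω (p.1, j, p.2)|)
  have h8 : 0 ≤ |S.δ k ω p| * |S.A k ω p.1 j| *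
    (|S.f j p.1 (S.x k ω j - S.x k ω p.1)| * |S.ξStack k ω (p.1, j, p.2)|) := by positivity
  rw [mul_pow, mul_pow] at h7
  linarith

theorem A2.condLE_noiseInner (hA2 : S.A2 P) (hA1 : S.A1) (hb : S.UniformBound P h ρ₀)
    (hρ₀ : 0 ≤ ρ₀) {k : ℕ} (ha : 0 ≤ S.a k) (hbk : 0 ≤ S.b k)
    (hX : Integrable (fun ω => 1 + ‖S.δ k ω‖ ^ 2) P) :
    CondLE P (S.past k) (S.noiseInner k) fun _ => 0 := by
  have := ((hA2.condLE_inner_measNoise hb hX).const_mul ha).add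
    ((hA2.condLE_inner_commNoise hA1 hb hρ₀ hX).const_mul hbk)
  simp only [mul_zero, add_zero] at this
  exact this

theorem UniformBound.integrable_gram_apply (hb : S.UniformBound P h ρ₀) (k : ℕ)
    (p q : Fin N × Fin n) : Integrable (fun ω => S.gram k ω p q) P := by
  refine (hb.integrable_frobSq k).mono' (S.measurable_gram k p q).aestronglyMeasurable
    (ae_of_all _ fun ω => (abs_apply_le_specNorm _ p q).trans ?_)
  exact ContinuousLinearMap.opNorm_le_bound _ (S.frobSq_nonneg k ω) (S.norm_gram_mulVec_le k ω)

theorem UniformBound.integrable_lapSym (hb : S.UniformBound P h ρ₀) (k : ℕ) (i j : Fin N) :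
    Integrable (fun ω => S.lapSym k ω i j) P := by
  refine (integrable_const ρ₀).mono' ?_ ?_
  · simp only [lapSym, Matrix.smul_apply, Matrix.add_apply, transpose_apply, smul_eq_mul]
    exact (((S.measurable_lap k i j).add (S.measurable_lap k j i)).const_mul _).aestronglyMeasurable
  · filter_upwards [hb.abs_lap_le] with ω hω
    exact abs_lapSym_le_of_abs_lap_le (hω k) i j

theorem UniformBound.condExp_gainMat (hb : S.UniformBound P h ρ₀) (m i : ℕ)
    (p q : Fin N × Fin n) :
    Integrable (fun ω => S.gainMat i (S.lapSym i ω) ω p q) P ∧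
      P[fun ω => S.gainMat i (S.lapSym i ω) ω p q | S.past m] =ᵐ[P]
        fun ω => S.condGainMat P m i ω p q := by
  have h1 := hb.integrable_lapSym i p.1 q.1
  have h2 := hb.integrable_gram_apply i p q
  have heq : (fun ω => S.gainMat i (S.lapSym i ω) ω p q) =
      (S.b i * (1 : Matrix (Fin n) (Fin n) ℝ) p.2 q.2) • (fun ω => S.lapSym i ω p.1 q.1) +
      S.a i • fun ω => S.gram i ω p q := by
    funext ω
    simp only [gainMat, Matrix.add_apply, Matrix.smul_apply, kroneckerMap_apply, Pi.add_apply,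
      Pi.smul_apply, smul_eq_mul]
    ring
  rw [heq]
  refine ⟨(h1.smul _).add (h2.smul _), ?_⟩
  filter_upwards [condExp_add (h1.smul (S.b i * (1 : Matrix (Fin n) (Fin n) ℝ) p.2 q.2))
    (h2.smul (S.a i)) (S.past m), condExp_smul (μ := P)
    (S.b i * (1 : Matrix (Fin n) (Fin n) ℝ) p.2 q.2) (fun ω => S.lapSym i ω p.1 q.1) (S.past m),
    condExp_smul (μ := P) (S.a i) (fun ω => S.gram i ω p q) (S.past m)] with ω e1 e2 e3
  rw [e1, Pi.add_apply, e2, e3]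
  simp only [condGainMat, condMat, of_apply, Matrix.add_apply, Matrix.smul_apply,
    kroneckerMap_apply, Pi.smul_apply, smul_eq_mul]
  ring

/-- The products of coordinates of `S.δ m` are known at time `m` and come out of the conditional
expectation entry by entry; `R` serves to dominate the entries. -/
theorem UniformBound.condExp_inner_gainMat (hb : S.UniformBound P h ρ₀) (hρ₀ : 0 ≤ ρ₀)
    {R : Ω → ℝ} {m i : ℕ} (ha : 0 ≤ S.a i) (hbi : 0 ≤ S.b i) (hl : 0 ≤ S.lam i)
    (hR : Integrable (fun ω => R ω * (1 + ‖S.δ m ω‖ ^ 2)) P)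
    (hle : ∀ᵐ ω ∂P, N * n * ρ₀ + S.frobSq i ω ≤ R ω) :
    Integrable (fun ω => inner ℝ (S.δ m ω)
      (toEuclideanLin (S.gainMat i (S.lapSym i ω) ω) (S.δ m ω))) P ∧
    P[fun ω => inner ℝ (S.δ m ω) (toEuclideanLin (S.gainMat i (S.lapSym i ω) ω) (S.δ m ω)) |
      S.past m] =ᵐ[P] fun ω => (S.δ m ω).ofLp ⬝ᵥ S.condGainMat P m i ω *ᵥ (S.δ m ω).ofLp := by
  have hexp : (fun ω => inner ℝ (S.δ m ω)
      (toEuclideanLin (S.gainMat i (S.lapSym i ω) ω) (S.δ m ω))) =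
      ∑ p, ∑ q, (fun ω => S.δ m ω p * S.δ m ω q) * fun ω => S.gainMat i (S.lapSym i ω) ω p q := by
    funext ω
    simp only [PiLp.inner_apply, RCLike.inner_apply, conj_trivial, Matrix.toLpLin_apply, mulVec,
      dotProduct, Finset.sum_apply, Pi.mul_apply, Finset.sum_mul]
    exact Finset.sum_congr rfl fun p _ => Finset.sum_congr rfl fun q _ => by ring
  have hmeas : ∀ p q, Measurable[S.past m] fun ω => S.δ m ω p * S.δ m ω q := fun p q =>
    (S.measurable_δ_apply_past m p).mul (S.measurable_δ_apply_past m q)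
  have hint : ∀ p q, Integrable ((fun ω => S.δ m ω p * S.δ m ω q) *
      fun ω => S.gainMat i (S.lapSym i ω) ω p q) P := by
    intro p q
    refine (hR.const_mul (S.gainSum i)).mono'
      (((hmeas p q).mono (S.past_le m) le_rfl).aestronglyMeasurable.mul
        (hb.condExp_gainMat m i p q).1.1) ?_
    filter_upwards [hle, hb.abs_lap_le] with ω hle hL
    have hG : 0 ≤ S.gainSum i := by rw [gainSum]; positivity
    have hf := S.frobSq_nonneg i ω
    have hB : |S.gainMat i (S.lapSym i ω) ω p q| ≤ S.gainSum i * R ω := by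
      refine (abs_apply_le_specNorm _ p q).trans
        ((ContinuousLinearMap.opNorm_le_bound _ (by positivity) fun d => ?_).trans
        (mul_le_mul_of_nonneg_left hle hG))
      rw [mul_assoc]
      exact S.norm_gainMat_le hρ₀ (abs_lapSym_le_of_abs_lap_le (hL i)) ha hbi hl d
    have hd : |S.δ m ω p * S.δ m ω q| ≤ 1 + ‖S.δ m ω‖ ^ 2 := by
      rw [abs_mul]
      have := mul_le_mul (abs_δ_apply_le (S := S) m ω p) (abs_δ_apply_le (S := S) m ω q)
        (abs_nonneg _) (norm_nonneg _)
      nlinarith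
    rw [Pi.mul_apply, Real.norm_eq_abs, abs_mul]
    refine (mul_le_mul hd hB (abs_nonneg _) (by positivity)).trans (le_of_eq (by ring))
  rw [hexp]
  refine ⟨integrable_finsetSum' _ fun p _ => integrable_finsetSum' _ fun q _ => hint p q, ?_⟩
  have h1 := condExp_finsetSum (μ := P) (s := Finset.univ)
    (f := fun p => ∑ q, (fun ω => S.δ m ω p * S.δ m ω q) *
      fun ω => S.gainMat i (S.lapSym i ω) ω p q)
    (fun p _ => integrable_finsetSum' _ fun q _ => hint p q) (S.past m)
  have h2 : ∀ᵐ ω ∂P, ∀ p, (P[∑ q, (fun ω => S.δ m ω p * S.δ m ω q) *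
      (fun ω => S.gainMat i (S.lapSym i ω) ω p q) | S.past m]) ω =
      ∑ q, S.δ m ω p * S.δ m ω q * S.condGainMat P m i ω p q := by
    rw [ae_all_iff]
    intro p
    have h3 := condExp_finsetSum (μ := P) (s := Finset.univ)
      (f := fun q => (fun ω => S.δ m ω p * S.δ m ω q) *
        fun ω => S.gainMat i (S.lapSym i ω) ω p q) (fun q _ => hint p q) (S.past m)
    have h4 : ∀ᵐ ω ∂P, ∀ q, (P[(fun ω => S.δ m ω p * S.δ m ω q) *
        (fun ω => S.gainMat i (S.lapSym i ω) ω p q) | S.past m]) ω =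
        S.δ m ω p * S.δ m ω q * S.condGainMat P m i ω p q := by
      rw [ae_all_iff]
      intro q
      filter_upwards [condExp_mul_of_stronglyMeasurable_left (μ := P)
        (hmeas p q).stronglyMeasurable (hint p q) (hb.condExp_gainMat m i p q).1,
        (hb.condExp_gainMat m i p q).2] with ω e1 e2
      rw [e1, Pi.mul_apply, e2]
    filter_upwards [h3, h4] with ω h3 h4
    rw [h3, Finset.sum_apply]
    exact Finset.sum_congr rfl fun q _ => h4 q
  filter_upwards [h1, h2] with ω h1 h2
  rw [h1, Finset.sum_apply]
  simp only [h2, dotProduct, mulVec, Finset.mul_sum]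
  exact Finset.sum_congr rfl fun p _ => Finset.sum_congr rfl fun q _ => by ring

end StepMoments

end RegressionNetwork

/-! ### Assembly of the drift inequality. -/

namespace RegressionNetwork

open Matrix

section Drift

variable {Ω : Type*} [mΩ : MeasurableSpace Ω] {P : Measure Ω} {N n : ℕ}
  {S : RegressionNetwork Ω N n} {h : ℕ} {ρ₀ : ℝ}

/-- All `h` forms are evaluated at the same vector, so they add up before the minimum eigenvalue is
taken; single summands need not be positive. -/
theorem Lam_mul_V_le (h k : ℕ) (ω : Ω) :
    S.Lam P h k ω * S.V (k * h) ω ≤ ∑ j ∈ Finset.range h,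
      (S.δ (k * h) ω).ofLp ⬝ᵥ S.condGainMat P (k * h) (k * h + j) ω *ᵥ (S.δ (k * h) ω).ofLp := by
  have hLam : S.Lam P h k ω =
      lambdaMin (∑ j ∈ Finset.range h, S.condGainMat P (k * h) (k * h + j) ω) := by
    rw [Lam, Finset.sum_Ico_eq_sum_range, add_mul, one_mul, Nat.add_sub_cancel_left]
    rfl
  have hV : S.V (k * h) ω = (S.δ (k * h) ω).ofLp ⬝ᵥ (S.δ (k * h) ω).ofLp := by
    rw [V, EuclideanSpace.real_norm_sq_eq]
    simp only [dotProduct, sq]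
  have hherm : (∑ j ∈ Finset.range h, S.condGainMat P (k * h) (k * h + j) ω).IsHermitian := by
    rw [Matrix.IsHermitian, conjTranspose_sum]
    exact Finset.sum_congr rfl fun j _ => condGainMat_isHermitian (k * h) (k * h + j) ω
  rw [hLam, hV]
  refine (lambdaMin_mul_le_dotProduct hherm _).trans (le_of_eq ?_)
  rw [sum_mulVec, dotProduct_sum]

variable [IsProbabilityMeasure P]

/-- The `h`-step drift inequality, uniformly in the starting time. -/
theorem exists_drift_bound (hA1 : S.A1) (hA2 : S.A2 P) (ha : Antitone S.a) (ha0 : ∀ k, 0 ≤ S.a k)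
    (hb : Antitone S.b) (hb0 : ∀ k, 0 ≤ S.b k) (hlam : Antitone S.lam) (hlam0 : ∀ k, 0 ≤ S.lam k)
    (hρ₀ : 0 ≤ ρ₀) (hbound : S.UniformBound P h ρ₀) :
    (∀ k, Integrable (S.V k) P) ∧ ∃ K : ℝ, 0 ≤ K ∧ ∀ m, ∀ᵐ ω ∂P,
      (P[S.V (m + h) | S.past m]) ω ≤ S.V m ω
        - 2 * ∑ j ∈ Finset.range h,
          (S.δ m ω).ofLp ⬝ᵥ S.condGainMat P m (m + j) ω *ᵥ (S.δ m ω).ofLp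
        + K * ((S.gainSum m ^ 2 + S.lam m) * (1 + S.V m ω)) := by
  obtain ⟨σ, c, hf⟩ := id hA1
  obtain ⟨M, hM1, hM⟩ := S.exists_step_bounds hf hρ₀ ha0 hb0 hlam0
  obtain ⟨C, hC0, hC⟩ := hA2.condLE_stepFactor hbound (by linarith : 0 ≤ M)
  have hae : ∀ᵐ ω ∂P, ∀ k, (∀ i j, |S.A k ω i j| ≤ ρ₀) ∧ ∀ i j, |S.lap k ω i j| ≤ ρ₀ := by
    filter_upwards [hbound.abs_lap_le] with ω hω k
    exact ⟨abs_A_le_of_abs_lap_le hρ₀ (hω k), hω k⟩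
  have G : GainBoundedProcess P S.past S.δ (S.stepFactor M) S.gainSum C :=
    { mono := S.past_mono
      le := S.past_le
      adapted := fun k => (S.measurable_δ_past k).stronglyMeasurable
      integrable_zero := by simp only [δ, x]; exact integrable_const _
      R_nonneg := fun k ω => by
        have := S.frobSq_nonneg k ω
        have := S.noiseSq_nonneg k ω
        rw [stepFactor]
        positivity
      C_nonneg := hC0
      R_condLE := hC
      e_anti := (ha.add hb).add hlam
      e_nonneg := fun k => add_nonneg (add_nonneg (ha0 k) (hb0 k)) (hlam0 k)
      step := fun k => by
        filter_upwards [hae] with ω hω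
        exact (hM k ω (hω k).1 (hω k).2).2.1 }
  have hQ := fun m j => hbound.condExp_inner_gainMat (m := m) (i := m + j) hρ₀ (ha0 _) (hb0 _)
    (hlam0 _) ((hC (m + j)).mul_left (Z := fun ω => 1 + ‖S.δ m ω‖ ^ 2) (G.le _) (G.R_nonneg _)
      ((G.adapted_one_add m).mono (G.mono (Nat.le_add_right m j))) (fun ω => by positivity)
      (G.integrable_one_add m)).1
    (by
      filter_upwards [hae] with ω hω
      exact (hM (m + j) ω (hω _).1 (hω _).2).1)
  refine ⟨G.integrable_norm_sq, ?_⟩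
  obtain ⟨K, hK0, hK⟩ := G.condLE_drift
    -- The symmetrized Laplacian gives the same form as the one in the dynamics, and its conditional
    -- mean is the one occurring in `S.Lam`.
    (Q := fun k ω d => inner ℝ d (toEuclideanLin (S.gainMat k (S.lapSym k ω) ω) d))
    (ζ := S.noiseInner) hlam hlam0
    (fun k => hA2.condLE_noiseInner hA1 hbound hρ₀ (ha0 k) (hb0 k) (G.integrable_one_add k))
    (fun m j => (hQ m j).1)
    (fun k => by
      filter_upwards [hae] with ω hω d d'
      refine (S.abs_inner_gainMat_sub_le hρ₀ (abs_lapSym_le_of_abs_lap_le (hω k).2) (ha0 k)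
        (hb0 k) (hlam0 k) d d').trans ?_
      exact mul_le_mul_of_nonneg_left (mul_le_mul_of_nonneg_right (hM k ω (hω k).1 (hω k).2).1
        (by positivity)) (G.e_nonneg k))
    (fun k => by
      filter_upwards [hae] with ω hω
      have := (hM k ω (hω k).1 (hω k).2).2.2
      rwa [inner_gainMat] at this) h
  refine ⟨K, hK0, fun m => ?_⟩
  have hi : ∀ j ∈ Finset.range h, Integrable (fun ω => inner ℝ (S.δ m ω)
      (toEuclideanLin (S.gainMat (m + j) (S.lapSym (m + j) ω) ω) (S.δ m ω))) P :=
    fun j _ => (hQ m j).1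
  have hsum := condExp_finsetSum hi (S.past m)
  have hadd := condExp_add (G.integrable_norm_sq (m + h))
    ((integrable_finsetSum' _ hi).smul (2 : ℝ)) (S.past m)
  have hsmul := condExp_smul (μ := P) (2 : ℝ) (∑ j ∈ Finset.range h, fun ω => inner ℝ (S.δ m ω)
      (toEuclideanLin (S.gainMat (m + j) (S.lapSym (m + j) ω) ω) (S.δ m ω))) (S.past m)
  have heq : (fun ω => ‖S.δ (m + h) ω‖ ^ 2 + 2 * ∑ j ∈ Finset.range h, inner ℝ (S.δ m ω)
      (toEuclideanLin (S.gainMat (m + j) (S.lapSym (m + j) ω) ω) (S.δ m ω))) =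
      (fun ω => ‖S.δ (m + h) ω‖ ^ 2) + (2 : ℝ) • ∑ j ∈ Finset.range h, fun ω => inner ℝ (S.δ m ω)
      (toEuclideanLin (S.gainMat (m + j) (S.lapSym (m + j) ω) ω) (S.δ m ω)) := by
    funext ω
    simp
  have hKm := (hK m).2
  rw [heq] at hKm
  have hQae : ∀ᵐ ω ∂P, ∀ j, (P[fun ω => inner ℝ (S.δ m ω)
      (toEuclideanLin (S.gainMat (m + j) (S.lapSym (m + j) ω) ω) (S.δ m ω)) | S.past m]) ω =
      (S.δ m ω).ofLp ⬝ᵥ S.condGainMat P m (m + j) ω *ᵥ (S.δ m ω).ofLp :=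
    ae_all_iff.2 fun j => (hQ m j).2
  filter_upwards [hKm, hsum, hadd, hsmul, hQae] with ω h1 h2 h3 h4 h5
  rw [h3, Pi.add_apply, h4, Pi.smul_apply, h2, Finset.sum_apply, smul_eq_mul] at h1
  simp only [h5] at h1
  have h6 : (P[S.V (m + h) | S.past m]) ω = (P[fun ω => ‖S.δ (m + h) ω‖ ^ 2 | S.past m]) ω := rfl
  rw [h6, V]
  linarith

end Drift

end RegressionNetwork

theorem lemma1 {Ω : Type*} [MeasurableSpace Ω] (P : Measure Ω) [IsProbabilityMeasure P]
    {N n : ℕ} (S : RegressionNetwork Ω N n) (hA1 : S.A1) (hA2 : S.A2 P)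
    (ha : Antitone S.a) (ha0 : Tendsto S.a atTop (𝓝 0))
    (hb : Antitone S.b) (hb0 : Tendsto S.b atTop (𝓝 0))
    (hlam : Antitone S.lam) (hlam0 : Tendsto S.lam atTop (𝓝 0))
    (h : ℕ) (hh : 0 < h) (ρ₀ : ℝ) (hρ₀ : 0 < ρ₀) (hbound : S.UniformBound P h ρ₀) :
    (∀ k, Integrable (S.V k) P) ∧
    ∃ Om Ga : ℕ → ℝ, (∀ k, 0 ≤ Om k) ∧ (∀ k, 0 ≤ Ga k) ∧
      ((fun k => Om k + Ga k) =O[atTop]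
        fun k => S.a (k * h) ^ 2 + S.b (k * h) ^ 2 + S.lam (k * h)) ∧
      ∃ k₀ : ℕ, 0 < k₀ ∧ ∀ k, k₀ ≤ k → ∀ᵐ ω ∂P,
        (P[S.V ((k + 1) * h) | S.past (k * h)]) ω ≤
          (1 + Om k) * S.V (k * h) ω
          - 2 * (S.Lam P h k ω + ∑ i ∈ Finset.Ico (k * h) ((k + 1) * h), S.lam i)
              * S.V (k * h) ω
          + Ga k := by
  have ha' : ∀ k, 0 ≤ S.a k := ha.le_of_tendsto ha0
  have hb' : ∀ k, 0 ≤ S.b k := hb.le_of_tendsto hb0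
  have hlam' : ∀ k, 0 ≤ S.lam k := hlam.le_of_tendsto hlam0
  obtain ⟨hVi, K, hK0, hK⟩ := RegressionNetwork.exists_drift_bound hA1 hA2 ha ha' hb hb' hlam
    hlam' hρ₀.le hbound
  have hE : ∀ m, 0 ≤ S.gainSum m ^ 2 + S.lam m := fun m => add_nonneg (sq_nonneg _) (hlam' m)
  -- The extra 2hλ(kh) in Ω pays for the term −2Σλ(i)V, since the sum is at most hλ(kh). The
  -- inequality then holds for every k, and 1 is a valid threshold.
  refine ⟨hVi, fun k => K * (S.gainSum (k * h) ^ 2 + S.lam (k * h)) + 2 * h * S.lam (k * h),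
    fun k => K * (S.gainSum (k * h) ^ 2 + S.lam (k * h)), fun k => ?_,
    fun k => mul_nonneg hK0 (hE _), ?_, 1, one_pos, fun k _ => ?_⟩
  · exact add_nonneg (mul_nonneg hK0 (hE _)) (mul_nonneg (by positivity) (hlam' _))
  -- From (a + b + λ)² ≤ 3(a² + b² + λ²) and λ² ≤ λ(0)λ: the square of λ is absorbed into its first
  -- power.
  · refine IsBigO.of_bound (2 * K * (3 * (1 + S.lam 0) + 1) + 2 * h) (Eventually.of_forall fun k => ?_)
    have hl := hlam' (k * h)
    have hl0 := hlam' 0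
    have hll := hlam (Nat.zero_le (k * h))
    have h1 : S.gainSum (k * h) ^ 2 + S.lam (k * h) ≤ (3 * (1 + S.lam 0) + 1) *
        (S.a (k * h) ^ 2 + S.b (k * h) ^ 2 + S.lam (k * h)) := by
      rw [RegressionNetwork.gainSum]
      generalize S.a (k * h) = a
      generalize S.b (k * h) = b
      generalize S.lam (k * h) = l at *
      have h2 : (a + b + l) ^ 2 ≤ 3 * (a ^ 2 + b ^ 2 + l ^ 2) := by
        nlinarith [sq_nonneg (a - b), sq_nonneg (b - l), sq_nonneg (a - l)]
      have h3 := mul_le_mul_of_nonneg_right hll hl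
      have h4 : 0 ≤ S.lam 0 * (a ^ 2 + b ^ 2) := by positivity
      nlinarith [sq_nonneg a, sq_nonneg b]
    have h0 : 0 ≤ S.a (k * h) ^ 2 + S.b (k * h) ^ 2 + S.lam (k * h) := by positivity
    have hKE := mul_nonneg hK0 (hE (k * h))
    rw [Real.norm_of_nonneg (by positivity), Real.norm_of_nonneg h0]
    have h5 := mul_le_mul_of_nonneg_left h1 hK0
    have h6 : (0 : ℝ) ≤ h * (S.a (k * h) ^ 2 + S.b (k * h) ^ 2) := by positivity
    linarith
  · have hkh : (k + 1) * h = k * h + h := by ring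
    have hsl : ∑ i ∈ Finset.Ico (k * h) ((k + 1) * h), S.lam i ≤ h * S.lam (k * h) := by
      refine (Finset.sum_le_card_nsmul _ _ _ fun i hi => hlam (Finset.mem_Ico.1 hi).1).trans
        (le_of_eq ?_)
      rw [Nat.card_Ico, hkh, Nat.add_sub_cancel_left, nsmul_eq_mul]
    filter_upwards [hK (k * h)] with ω hω
    have hL := RegressionNetwork.Lam_mul_V_le (S := S) (P := P) h k ω
    have hV : 0 ≤ S.V (k * h) ω := sq_nonneg _
    have h1 := mul_le_mul_of_nonneg_right hsl hV
    rw [hkh] at h1 ⊢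
    linarith
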